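/- A random 3-SAT instance with $N$ Boolean variables and $M$ clauses is a uniformly random set of $M$ distinct clauses, a clause being a disjunction of three literals with no repeated and no complementary literals (the clauses are listed in uniformly random order). Given a partial assignment $A$, clauses with a true literal disappear; any other clause becomes an $\ell$-clause, where $\ell$ is the number of its unset literals. The procedure #DPLL-UC, started with $A=\emptyset$, works as follows. (1) If no clause is left, the current node is a solution leaf. (2) If there is a $0$-clause, it is a contradiction leaf. (3) Otherwise, if there are $1$-clauses, one of them is picked and its literal is set to true, which gives one child; if there is none, a literal is chosen uniformly at random among the unset ones and the node gets two children, on which the procedure is run with independent random choices, one with this literal set to true and one with it set to false. The rule that picks the $1$-clause is an arbitrary, possibly randomized, rule that points to a clause knowing only the current and past residual lengths of all the clauses along the branch, not their literals. The height of a node is the number of variables set. Let $L_C(N,T,\alpha)$ be the expected number (over the instance and the choices of the procedure) of contradiction leaves at height $T$ in the search tree of a random 3-SAT instance with $N$ variables and $\lfloor\alpha N\rfloor$ clauses, and let $$\Omega(t,\alpha,k)=t+\alpha\log_2\Big(1-\frac{k}{2^k}t^{k-1}+\frac{k-1}{2^k}t^k\Big).$$ For every $\alpha>0$ there is $\varepsilon_0>0$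 such that for every $\varepsilon\in(0,\varepsilon_0)$, $$\Omega(t,\alpha,3)\;\le\;\frac1N\log_2 L_C(N,\lfloor tN\rfloor,\alpha)+o(1)\;\le\;\max_{h\in[\varepsilon,t]}\Omega(h,\alpha,3)\qquad (N\to\infty)$$ uniformly in $t\in[\varepsilon,1-\varepsilon]$ and in the rule. That is, for every $\delta>0$ there is $N_0$ such that, for all $N\ge N_0$, all such rules and all $t\in[\varepsilon,1-\varepsilon]$, one has $L_C(N,\lfloor tN\rfloor,\alpha)>0$ and $$\Omega(t,\alpha,3)-\delta\;\le\;\frac1N\log_2 L_C(N,\lfloor tN\rfloor,\alpha)\;\le\;\max_{h\in[\varepsilon,t]}\Omega(h,\alpha,3)+\delta .$$ -/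

import Mathlib

open scoped BigOperators ENNReal

noncomputable section

namespace DPLL

/-- A literal on `N` Boolean variables: `(v, true)` is the variable `v`, `(v, false)` its negation. -/
abbrev Lit (N : ℕ) := Fin N × Bool

/-- The complementary literal. -/
def Lit.compl {N : ℕ} (l : Lit N) : Lit N := (l.1, !l.2)

/-- Disjunctions of `k` literals, with no repetition and no complementary literals. -/
abbrev Clause (N k : ℕ) :=
  {c : Finset (Lit N) // c.card = k ∧ ∀ v, ¬ ((v, true) ∈ c ∧ (v, false) ∈ c)}

/-- A partial assignment: `none` marks the unset variables. -/
abbrev Assignment (N : ℕ) := Fin N → Option Bool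

/-- The literals over variables that are unset under `A`. -/
def unsetLits {N : ℕ} (A : Assignment N) : Finset (Lit N) :=
  Finset.univ.filter fun l => A l.1 = none

/-- The literals of the clause `c` that are unset under `A`. -/
def freeLits {N k : ℕ} (A : Assignment N) (c : Clause N k) : Finset (Lit N) :=
  c.1.filter fun l => A l.1 = none

/-- What is left of the clause `c` given `A`: `none` if `A` makes one of its literals true
(the clause disappears); otherwise `some ℓ`, where `ℓ` is the number of its literals that are
not false under `A`, that is, `c` has become an `ℓ`-clause. -/
def residual {N k : ℕ} (A : Assignment N) (c : Clause N k) : Option ℕ :=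
  if ∃ l ∈ c.1, A l.1 = some l.2 then none else some (freeLits A c).card

/-- The assignment `A ∪ S`, which moreover makes the literals of `S` true. -/
def extend {N : ℕ} (A : Assignment N) (S : Finset (Lit N)) : Assignment N := fun v =>
  if (v, true) ∈ S then some true else if (v, false) ∈ S then some false else A v

/-- The lengths of what is left of each of the `M` clauses of an instance. -/
abbrev Shape (M : ℕ) := Fin M → Option ℕ

/-- The shape of the residual instance of `F` given `A`. -/
def shape {N M k : ℕ} (F : Fin M → Clause N k) (A : Assignment N) : Shape M :=
  fun j => residual A (F j)

/-- A rule to pick a 1-clause for unit-propagation. It points to a 1-clause, possibly at random,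
knowing the lengths of the residual clauses, now and (`history`) at all the
ancestors of the current node, but not the literals in them. -/
structure UnitRule (M : ℕ) where
  pick : (history : List (Shape M)) → (s : Shape M) → (∃ j, s j = some 1) → PMF (Fin M)
  pick_unit : ∀ history s h, ∀ j ∈ (pick history s h).support, s j = some 1

/-- Search trees. The root is at height `0`; every edge sets one more variable, so the
height of a node is the length of the assignment it carries. -/
inductive SearchTree : Type
  | solution : SearchTree
  | contradiction : SearchTree
  | unitProp : SearchTree → SearchTree
  | split : SearchTree → SearchTree → SearchTree

/-- The number of contradiction leaves at height `T` of a search tree. -/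
def SearchTree.contradictionLeaves : SearchTree → ℕ → ℕ
  | .solution, _ => 0
  | .contradiction, T => if T = 0 then 1 else 0
  | .unitProp _, 0 => 0
  | .unitProp c, T + 1 => c.contradictionLeaves T
  | .split _ _, 0 => 0
  | .split l r, T + 1 => l.contradictionLeaves T + r.contradictionLeaves T

theorem unsetLits_nonempty {N M k : ℕ} {F : Fin M → Clause N k} {A : Assignment N}
    (hS : ¬ ∀ j, shape F A j = none) (hC : ¬ ∃ j, shape F A j = some 0) :
    (unsetLits A).Nonempty := by
  push Not at hS hC
  obtain ⟨j, hj⟩ := hS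
  have h0 := hC j
  unfold shape residual at hj h0
  split_ifs at hj h0 with h
  · exact absurd rfl hj
  · have hne : (freeLits A (F j)).card ≠ 0 := fun h => h0 (by rw [h])
    obtain ⟨l, hl⟩ := Finset.card_pos.mp (Nat.pos_of_ne_zero hne)
    exact ⟨l, by simpa [unsetLits] using (Finset.mem_filter.mp hl).2⟩

open Classical in
/-- The law of the search tree of the procedure #DPLL-UC called on the instance `F` with the
assignment `A`, when `A` leaves `n` variables unset (`n = 0`: every clause is
satisfied or empty). -/
def dpllUC {N M k : ℕ} (σ : UnitRule M) (F : Fin M → Clause N k) :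
    (n : ℕ) → (history : List (Shape M)) → (A : Assignment N) → PMF SearchTree
  | 0, _, A =>
    if ∀ j, shape F A j = none then PMF.pure .solution else PMF.pure .contradiction
  | n + 1, history, A =>
    if hS : ∀ j, shape F A j = none then PMF.pure .solution
    else if hC : ∃ j, shape F A j = some 0 then PMF.pure .contradiction
    else if hU : ∃ j, shape F A j = some 1 then
      (σ.pick history (shape F A) hU).bind fun j =>
        (dpllUC σ F n (shape F A :: history) (extend A (freeLits A (F j)))).map .unitProp
    else
      (PMF.uniformOfFinset (unsetLits A) (unsetLits_nonempty hS hC)).bind fun l =>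
        (dpllUC σ F n (shape F A :: history) (extend A {l})).bind fun tl =>
          (dpllUC σ F n (shape F A :: history) (extend A {Lit.compl l})).map fun tr =>
            .split tl tr

/-- The expected number of contradiction leaves at height `T` in the #DPLL-UC search tree of the
instance `F`; the expectation is over the random choices of the procedure. -/
def expectedLeaves {N M k : ℕ} (σ : UnitRule M) (F : Fin M → Clause N k) (T : ℕ) : ℝ :=
  (∑' τ : SearchTree, dpllUC σ F N [] (fun _ => none) τ *
    (τ.contradictionLeaves T : ℝ≥0∞)).toReal

open Classical in
/-- The expected number of contradiction leaves at height `T` in the #DPLL-UC search tree of a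
random 3-SAT instance with `N` variables and `M` clauses: a uniformly random set of `M`
clauses, listed in a uniformly random order. -/
def LC (N M : ℕ) (σ : UnitRule M) (T : ℕ) : ℝ :=
  (∑ F : Fin M ↪ Clause N 3, expectedLeaves σ F T) / (Fintype.card (Fin M ↪ Clause N 3) : ℝ)

/-- The exponent `Ω(t, α, k)`. -/
def Omega (t α : ℝ) (k : ℕ) : ℝ :=
  t + α * Real.logb 2 (1 - (k : ℝ) / 2 ^ k * t ^ (k - 1) + ((k : ℝ) - 1) / 2 ^ k * t ^ k)

end DPLL

end

/-! The proof is a first-moment computation made exact by a choice of weights. Clauses are first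
taken independent and uniform, repetitions being allowed. As the rule of unit propagation sees only
residual lengths, the residual clauses remain independent and uniform given the lengths seen so far
(`Unif.step`), and each clause shortens according to a fixed Markov chain, encoded in `evolve`.

A splitting doubles the number of nodes whereas unit propagation does not. This is repaired by
weights: if a 1-clause is worth half a satisfied clause (`Balanced`), the picked clause gains a
factor 2 when it is satisfied, which replaces the missing child. Hence the mean sum over the nodes
of height `H` of a product of balanced weights is `2 ^ H` times a product over the clauses of
one-clause means, for every rule (`sum_nodeSum`). With `liveWeight` the one-clause mean is `survival
(H / N)` up to `1 / N`, and the growth rate is `Omega`.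

Upper bound: a tree has no more contradiction leaves than about its number of splittings
(`nodeSum_le_sum_split`), and a splitting node, having no 0- or 1-clause, has live weight 1. Summing
over all heights up to `T` gives the maximum of `Omega` on `[0, t]`; the part below `ε` is harmless
because `Omega` increases there (`Omega_three_mono`).

Lower bound: at the parents of the leaves, two fixed clauses are required to have just become
1-clauses, another balanced weight (`newUnitWeight`). The picked 1-clause contradicts one of them
with probability `1 / (2 (N - T))`, whichever clause is picked (`sum_nodeSum_pickOpposite`). All
this costs only a power of `N`.

Distinctness of the clauses costs a bounded factor, as there are of order `N ^ 3` possible clauses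
for `M` of order `N`. Above, one divides by the number of injections
(`pow_le_two_mul_descFactorial`); below, instances with a repetition are reduced to instances with
one clause fewer and subtracted (`le_LC`, `le_LC_of_large`). -/

noncomputable section

namespace DPLL

section Clauses

/-! ### Clauses under a partial assignment -/

theorem Lit.compl_ne {N : ℕ} (l : Lit N) : Lit.compl l ≠ l := by
  rcases l with ⟨v, b⟩
  simp [Lit.compl]

theorem Lit.eq_or_eq_compl {N : ℕ} {l m : Lit N} (h : m.1 = l.1) : m = l ∨ m = Lit.compl l := by
  rcases l with ⟨v, b⟩
  rcases m with ⟨w, c⟩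
  simp only at h
  subst h
  cases b <;> cases c <;> simp [Lit.compl]

theorem extend_singleton {N : ℕ} (A : Assignment N) (l : Lit N) :
    extend A {l} = Function.update A l.1 (some l.2) := by
  funext v
  rcases l with ⟨w, b⟩
  by_cases hv : v = w
  · subst hv
    cases b <;> simp [extend]
  · simp [extend, Function.update, hv]

/-- The set of literals `r` contains no complementary pair. -/
def Consistent {N : ℕ} (r : Finset (Lit N)) : Prop :=
  ∀ v, ¬ ((v, true) ∈ r ∧ (v, false) ∈ r)

theorem Consistent.compl_notMem {N : ℕ} {r : Finset (Lit N)} (h : Consistent r) {l : Lit N}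
    (hl : l ∈ r) : Lit.compl l ∉ r := by
  rcases l with ⟨v, b⟩
  intro hc
  cases b
  · exact h v ⟨by simpa [Lit.compl] using hc, hl⟩
  · exact h v ⟨hl, by simpa [Lit.compl] using hc⟩

theorem consistent_iff {N : ℕ} {r : Finset (Lit N)} :
    Consistent r ↔ ∀ l ∈ r, Lit.compl l ∉ r :=
  ⟨fun h _ hl => h.compl_notMem hl, fun h v hv => h _ hv.1 (by simpa [Lit.compl] using hv.2)⟩

open Classical in
/-- The clauses of length `ℓ` over the variables that are unset under `A`. -/
def subclauses {N : ℕ} (A : Assignment N) (ℓ : ℕ) : Finset (Finset (Lit N)) :=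
  ((unsetLits A).powersetCard ℓ).filter Consistent

/-- The number of unset variables. -/
def numUnset {N : ℕ} (A : Assignment N) : ℕ := (Finset.univ.filter fun v => A v = none).card

theorem mem_unsetLits {N : ℕ} {A : Assignment N} {l : Lit N} :
    l ∈ unsetLits A ↔ A l.1 = none := by simp [unsetLits]

theorem compl_mem_unsetLits {N : ℕ} {A : Assignment N} {l : Lit N} (h : l ∈ unsetLits A) :
    Lit.compl l ∈ unsetLits A := by
  rw [mem_unsetLits] at h ⊢
  exact h

theorem card_unsetLits {N : ℕ} (A : Assignment N) : (unsetLits A).card = 2 * numUnset A := by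
  have : unsetLits A = (Finset.univ.filter fun v => A v = none) ×ˢ (Finset.univ : Finset Bool) := by
    ext l
    simp [unsetLits]
  rw [this, Finset.card_product]
  simp [numUnset, mul_comm]

theorem mem_unsetLits_extend {N : ℕ} {A : Assignment N} {l m : Lit N} :
    m ∈ unsetLits (extend A {l}) ↔ m ∈ unsetLits A ∧ m.1 ≠ l.1 := by
  rw [mem_unsetLits, mem_unsetLits, extend_singleton]
  by_cases h : m.1 = l.1
  · simp [h]
  · simp [Function.update, h]

theorem numUnset_extend {N : ℕ} {A : Assignment N} {l : Lit N} (hl : l ∈ unsetLits A) :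
    numUnset (extend A {l}) + 1 = numUnset A := by
  have : (Finset.univ.filter fun v => extend A {l} v = none)
      = (Finset.univ.filter fun v => A v = none).erase l.1 := by
    ext v
    rw [extend_singleton]
    by_cases h : v = l.1
    · simp [h]
    · simp [Function.update, h]
  rw [mem_unsetLits] at hl
  rw [numUnset, this, Finset.card_erase_add_one (by simpa using hl), numUnset]

theorem mem_subclauses {N : ℕ} {A : Assignment N} {ℓ : ℕ} {r : Finset (Lit N)} :
    r ∈ subclauses A ℓ ↔ (r ⊆ unsetLits A ∧ r.card = ℓ) ∧ Consistent r := by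
  simp [subclauses, Finset.mem_powersetCard]

theorem subclauses_zero {N : ℕ} (A : Assignment N) : subclauses A 0 = {∅} := by
  ext r
  rw [mem_subclauses, Finset.card_eq_zero, Finset.mem_singleton]
  constructor
  · exact fun h => h.1.2
  · rintro rfl
    exact ⟨⟨by simp, rfl⟩, by simp [Consistent]⟩

theorem notMem_of_mem_subclauses_extend {N : ℕ} {A : Assignment N} {l m : Lit N} {ℓ : ℕ}
    {r : Finset (Lit N)} (hr : r ∈ subclauses (extend A {l}) ℓ) (hm : m.1 = l.1) : m ∉ r :=
  fun h => (mem_unsetLits_extend.1 ((mem_subclauses.1 hr).1.1 h)).2 hm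

theorem insert_mem_subclauses {N : ℕ} {A : Assignment N} {l m : Lit N} {ℓ : ℕ}
    {r : Finset (Lit N)} (hm : m ∈ unsetLits A) (hml : m.1 = l.1)
    (hr : r ∈ subclauses (extend A {l}) ℓ) : insert m r ∈ subclauses A (ℓ + 1) := by
  have hn := fun x => notMem_of_mem_subclauses_extend (m := x) hr
  rw [mem_subclauses] at hr ⊢
  refine ⟨⟨?_, ?_⟩, ?_⟩
  · intro x hx
    rcases Finset.mem_insert.1 hx with rfl | hx
    · exact hm
    · exact (mem_unsetLits_extend.1 (hr.1.1 hx)).1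
  · rw [Finset.card_insert_of_notMem (hn m hml), hr.1.2]
  · rw [consistent_iff]
    intro x hx hc
    rw [Finset.mem_insert] at hx hc
    rcases hx with rfl | hx
    · rcases hc with hc | hc
      · exact Lit.compl_ne _ hc
      · exact hn (Lit.compl _) hml hc
    · rcases hc with hc | hc
      · apply hn x _ hx
        rw [← hml, ← hc]; rfl
      · exact hr.2.compl_notMem hx hc

theorem erase_mem_subclauses {N : ℕ} {A : Assignment N} {l m : Lit N} {ℓ : ℕ}
    {r : Finset (Lit N)} (hml : m.1 = l.1) (hr : r ∈ subclauses A (ℓ + 1)) (hmr : m ∈ r) :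
    r.erase m ∈ subclauses (extend A {l}) ℓ := by
  rw [mem_subclauses] at hr ⊢
  refine ⟨⟨?_, ?_⟩, ?_⟩
  · intro x hx
    rw [Finset.mem_erase] at hx
    rw [mem_unsetLits_extend]
    refine ⟨hr.1.1 hx.2, fun h => ?_⟩
    rcases Lit.eq_or_eq_compl (h.trans hml.symm) with h | h
    · exact hx.1 h
    · exact hr.2.compl_notMem hmr (h ▸ hx.2)
  · rw [Finset.card_erase_of_mem hmr, hr.1.2]; rfl
  · rw [consistent_iff]
    intro x hx hc
    exact hr.2.compl_notMem (Finset.mem_of_mem_erase hx) (Finset.mem_of_mem_erase hc)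

theorem mem_subclauses_extend {N : ℕ} {A : Assignment N} {l : Lit N} {ℓ : ℕ}
    {r : Finset (Lit N)} : r ∈ subclauses (extend A {l}) ℓ ↔
      r ∈ subclauses A ℓ ∧ l ∉ r ∧ Lit.compl l ∉ r := by
  constructor
  · intro hr
    refine ⟨?_, notMem_of_mem_subclauses_extend hr rfl, notMem_of_mem_subclauses_extend hr rfl⟩
    rw [mem_subclauses] at hr ⊢
    exact ⟨⟨fun x hx => (mem_unsetLits_extend.1 (hr.1.1 hx)).1, hr.1.2⟩, hr.2⟩
  · rintro ⟨hr, h1, h2⟩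
    rw [mem_subclauses] at hr ⊢
    refine ⟨⟨fun x hx => mem_unsetLits_extend.2 ⟨hr.1.1 hx, fun h => ?_⟩, hr.1.2⟩, hr.2⟩
    rcases Lit.eq_or_eq_compl h with rfl | rfl
    · exact h1 hx
    · exact h2 hx

theorem sum_subclauses_mem {N : ℕ} {A : Assignment N} {l m : Lit N}
    (hm : m ∈ unsetLits A) (hml : m.1 = l.1) (ℓ : ℕ) (g : Finset (Lit N) → ℝ) :
    ∑ r ∈ (subclauses A (ℓ + 1)).filter (m ∈ ·), g r
      = ∑ r ∈ subclauses (extend A {l}) ℓ, g (insert m r) := by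
  refine Finset.sum_bij' (fun r _ => r.erase m) (fun r _ => insert m r) ?_ ?_ ?_ ?_ ?_
  · intro r hr
    rw [Finset.mem_filter] at hr
    exact erase_mem_subclauses hml hr.1 hr.2
  · intro r hr
    rw [Finset.mem_filter]
    exact ⟨insert_mem_subclauses hm hml hr, Finset.mem_insert_self _ _⟩
  · intro r hr
    rw [Finset.mem_filter] at hr
    exact Finset.insert_erase hr.2
  · intro r hr
    exact Finset.erase_insert (notMem_of_mem_subclauses_extend hr hml)
  · intro r hr
    rw [Finset.mem_filter] at hr
    rw [Finset.insert_erase hr.2]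

/-- Sorting the clauses of length `ℓ + 1` by what they say about the variable of `l`. -/
theorem sum_subclauses_succ {N : ℕ} {A : Assignment N} {l : Lit N} (hl : l ∈ unsetLits A) (ℓ : ℕ)
    (g : Finset (Lit N) → ℝ) :
    ∑ r ∈ subclauses A (ℓ + 1), g r
      = ∑ r ∈ subclauses (extend A {l}) (ℓ + 1), g r
        + ∑ r ∈ subclauses (extend A {l}) ℓ, g (insert l r)
        + ∑ r ∈ subclauses (extend A {l}) ℓ, g (insert (Lit.compl l) r) := by
  rw [← sum_subclauses_mem hl rfl, ← sum_subclauses_mem (l := l) (compl_mem_unsetLits hl) rfl,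
    ← Finset.sum_filter_add_sum_filter_not (subclauses A (ℓ + 1)) (l ∈ ·),
    ← Finset.sum_filter_add_sum_filter_not ((subclauses A (ℓ + 1)).filter (l ∉ ·))
      (Lit.compl l ∈ ·), Finset.filter_filter, Finset.filter_filter]
  have h1 : (subclauses A (ℓ + 1)).filter (fun r => l ∉ r ∧ Lit.compl l ∈ r)
      = (subclauses A (ℓ + 1)).filter (Lit.compl l ∈ ·) := by
    refine Finset.filter_congr fun r hr => ⟨fun h => h.2, fun h => ⟨fun h' => ?_, h⟩⟩
    exact (mem_subclauses.1 hr).2.compl_notMem h' h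
  have h2 : (subclauses A (ℓ + 1)).filter (fun r => l ∉ r ∧ Lit.compl l ∉ r)
      = subclauses (extend A {l}) (ℓ + 1) := by
    ext r
    rw [Finset.mem_filter, mem_subclauses_extend]
  rw [h1, h2]
  ring

/-- Counting through `sum_subclauses_succ` is Pascal's rule, with a factor 2 for the sign of the
added literal. -/
theorem card_subclauses {N : ℕ} (A : Assignment N) (ℓ : ℕ) :
    (subclauses A ℓ).card = (numUnset A).choose ℓ * 2 ^ ℓ := by
  induction hn : numUnset A generalizing A ℓ with
  | zero =>
    have : unsetLits A = ∅ := by rw [← Finset.card_eq_zero, card_unsetLits, hn]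
    cases ℓ with
    | zero => simp [subclauses_zero]
    | succ ℓ =>
      rw [Nat.choose_zero_succ, zero_mul, Finset.card_eq_zero, Finset.eq_empty_iff_forall_notMem]
      intro r hr
      rw [mem_subclauses, this, Finset.subset_empty] at hr
      obtain ⟨⟨rfl, h⟩, -⟩ := hr
      simp at h
  | succ n ih =>
    cases ℓ with
    | zero => simp [subclauses_zero]
    | succ ℓ =>
      obtain ⟨l, hl⟩ : (unsetLits A).Nonempty := by
        rw [← Finset.card_pos, card_unsetLits, hn]; omega
      have hn' : numUnset (extend A {l}) = n := by have := numUnset_extend hl; omega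
      have := sum_subclauses_succ hl ℓ (fun _ => 1)
      simp only [Finset.sum_const, nsmul_eq_mul, mul_one] at this
      norm_cast at this
      rw [this, ih _ _ hn', ih _ _ hn', Nat.choose_succ_succ]
      ring

/-- Double counting of the incidences between literals and clauses of length `ℓ + 1`: removing `l`
turns the clauses through `l` into the subclauses of the extension. -/
theorem card_subclauses_extend {N : ℕ} {A : Assignment N} {l : Lit N} (hl : l ∈ unsetLits A)
    (ℓ : ℕ) : 2 * (numUnset A : ℝ) * (subclauses (extend A {l}) ℓ).card
      = (ℓ + 1) * (subclauses A (ℓ + 1)).card := by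
  rw [card_subclauses, card_subclauses, ← numUnset_extend hl]
  have := Nat.add_one_mul_choose_eq (numUnset (extend A {l})) ℓ
  have h : ((numUnset (extend A {l}) : ℝ) + 1) * ((numUnset (extend A {l})).choose ℓ : ℝ)
      = ((numUnset (extend A {l}) + 1).choose (ℓ + 1) : ℝ) * ((ℓ : ℝ) + 1) := by exact_mod_cast this
  push_cast
  rw [pow_succ]
  linear_combination (2 * 2 ^ ℓ : ℝ) * h

/-! ### Evolution of one clause -/

theorem residual_eq_some {N k : ℕ} {A : Assignment N} {c : Clause N k} {ℓ : ℕ} :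
    residual A c = some ℓ ↔ (¬ ∃ l ∈ c.1, A l.1 = some l.2) ∧ (freeLits A c).card = ℓ := by
  unfold residual
  split_ifs with h <;> simp [h]

theorem residual_eq_none {N k : ℕ} {A : Assignment N} {c : Clause N k} :
    residual A c = none ↔ ∃ l ∈ c.1, A l.1 = some l.2 := by
  unfold residual
  split_ifs with h <;> simp [h]

theorem mem_freeLits {N k : ℕ} {A : Assignment N} {c : Clause N k} {l : Lit N} :
    l ∈ freeLits A c ↔ l ∈ c.1 ∧ A l.1 = none := by simp [freeLits]

theorem freeLits_mem_subclauses {N k : ℕ} (A : Assignment N) (c : Clause N k) :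
    freeLits A c ∈ subclauses A (freeLits A c).card := by
  rw [mem_subclauses]
  refine ⟨⟨fun l hl => mem_unsetLits.2 (mem_freeLits.1 hl).2, rfl⟩, fun v hv => c.2.2 v ?_⟩
  exact ⟨(mem_freeLits.1 hv.1).1, (mem_freeLits.1 hv.2).1⟩

theorem freeLits_extend {N k : ℕ} {A : Assignment N} {l : Lit N} {c : Clause N k} :
    freeLits (extend A {l}) c = (freeLits A c).filter (fun m => m.1 ≠ l.1) := by
  ext m
  rw [mem_freeLits, Finset.mem_filter, mem_freeLits, ← mem_unsetLits, ← mem_unsetLits,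
    mem_unsetLits_extend, and_assoc]

theorem satisfied_extend {N k : ℕ} {A : Assignment N} {l : Lit N} (hl : l ∈ unsetLits A)
    {c : Clause N k} : (∃ m ∈ c.1, extend A {l} m.1 = some m.2) ↔
      (∃ m ∈ c.1, A m.1 = some m.2) ∨ l ∈ freeLits A c := by
  rw [mem_unsetLits] at hl
  rw [extend_singleton]
  constructor
  · rintro ⟨m, hm, h⟩
    by_cases hml : m.1 = l.1
    · right
      rw [hml, Function.update_self, Option.some_inj] at h
      have : m = l := Prod.ext hml h.symm
      subst this
      exact mem_freeLits.2 ⟨hm, hl⟩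
    · left
      rw [Function.update_of_ne hml] at h
      exact ⟨m, hm, h⟩
  · rintro (⟨m, hm, h⟩ | h)
    · refine ⟨m, hm, ?_⟩
      rw [Function.update_of_ne (fun h' => by rw [h', hl] at h; cases h), h]
    · exact ⟨l, (mem_freeLits.1 h).1, by simp⟩

theorem residual_extend_of_none {N k : ℕ} {A : Assignment N} {l : Lit N} (hl : l ∈ unsetLits A)
    {c : Clause N k} (h : residual A c = none) : residual (extend A {l}) c = none := by
  rw [residual_eq_none] at h ⊢
  exact (satisfied_extend hl).2 (Or.inl h)

theorem residual_extend_of_mem {N k : ℕ} {A : Assignment N} {l : Lit N} (hl : l ∈ unsetLits A)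
    {c : Clause N k} (h : l ∈ freeLits A c) : residual (extend A {l}) c = none := by
  rw [residual_eq_none]
  exact (satisfied_extend hl).2 (Or.inr h)

theorem residual_extend_of_notMem {N k : ℕ} {A : Assignment N} {l : Lit N}
    (hl : l ∈ unsetLits A) {c : Clause N k} {ℓ : ℕ} (hc : residual A c = some ℓ)
    (h : l ∉ freeLits A c) :
    residual (extend A {l}) c = some ((freeLits A c).filter (fun m => m.1 ≠ l.1)).card := by
  rw [residual_eq_some] at hc ⊢
  rw [satisfied_extend hl, freeLits_extend]
  exact ⟨not_or.2 ⟨hc.1, h⟩, rfl⟩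

theorem filter_insert_compl {N : ℕ} {A : Assignment N} {l m : Lit N} {ℓ : ℕ} {r : Finset (Lit N)}
    (hr : r ∈ subclauses (extend A {l}) ℓ) (hm : m.1 = l.1) :
    (insert m r).filter (fun m => m.1 ≠ l.1) = r := by
  rw [Finset.filter_insert, if_neg (by simpa using hm), Finset.filter_eq_self]
  exact fun x hx => (mem_unsetLits_extend.1 ((mem_subclauses.1 hr).1.1 hx)).2

theorem filter_eq_self_of_mem {N : ℕ} {A : Assignment N} {l : Lit N} {ℓ : ℕ} {r : Finset (Lit N)}
    (hr : r ∈ subclauses (extend A {l}) ℓ) : r.filter (fun m => m.1 ≠ l.1) = r := by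
  rw [Finset.filter_eq_self]
  exact fun x hx => (mem_unsetLits_extend.1 ((mem_subclauses.1 hr).1.1 hx)).2

/-- The weight `μ` on clauses is carried by clauses of residual length `s` given `A`, and it gives
the same weight to all possible residual clauses of that length. -/
def Unif {N k : ℕ} (A : Assignment N) (s : Option ℕ) (μ : Clause N k → ℝ) : Prop :=
  (∀ c, μ c ≠ 0 → residual A c = s) ∧ ∀ ℓ, s = some ℓ → ∃ κ : ℝ, ∀ f : Finset (Lit N) → ℝ,
    ∑ c, μ c * f (freeLits A c) = κ * ∑ r ∈ subclauses A ℓ, f r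

/-- The part of the weight `μ` on the clauses of residual length `s` given `A`. -/
def atResidual {N k : ℕ} (A : Assignment N) (s : Option ℕ) (μ : Clause N k → ℝ) :
    Clause N k → ℝ := fun c => if residual A c = s then μ c else 0

/-- A clause containing `l` disappears, one containing its complement loses that literal, the others
do not change. Each subclause over the remaining variables comes from exactly one clause of the
relevant kind, so the constant `κ` is preserved. -/
theorem sum_unsat_step {N k : ℕ} {A : Assignment N} {l : Lit N} {ℓ : ℕ} {μ : Clause N k → ℝ}
    {κ : ℝ} (hκ : ∀ f : Finset (Lit N) → ℝ,
      ∑ c, μ c * f (freeLits A c) = κ * ∑ r ∈ subclauses A (ℓ + 1), f r)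
    (hl : l ∈ unsetLits A) (f : Finset (Lit N) → ℝ) :
    ∑ c, μ c * (if l ∈ freeLits A c then 0 else
        f ((freeLits A c).filter fun m => m.1 ≠ l.1))
      = κ * (∑ r ∈ subclauses (extend A {l}) (ℓ + 1), f r
          + ∑ r ∈ subclauses (extend A {l}) ℓ, f r) := by
  rw [hκ fun r => if l ∈ r then 0 else f (r.filter fun m => m.1 ≠ l.1), sum_subclauses_succ hl]
  congr 1
  have h1 : ∀ r ∈ subclauses (extend A {l}) (ℓ + 1),
      (if l ∈ r then 0 else f (r.filter fun m => m.1 ≠ l.1)) = f r := by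
    intro r hr
    rw [if_neg (notMem_of_mem_subclauses_extend hr rfl), filter_eq_self_of_mem hr]
  have h2 : ∀ r ∈ subclauses (extend A {l}) ℓ, (if l ∈ insert l r then 0 else
      f ((insert l r).filter fun m => m.1 ≠ l.1)) = 0 := by
    intro r _
    simp
  have h3 : ∀ r ∈ subclauses (extend A {l}) ℓ, (if l ∈ insert (Lit.compl l) r then 0 else
      f ((insert (Lit.compl l) r).filter fun m => m.1 ≠ l.1)) = f r := by
    intro r hr
    rw [if_neg, filter_insert_compl (m := Lit.compl l) hr rfl]
    rw [Finset.mem_insert]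
    rintro (h | h)
    · exact Lit.compl_ne l h.symm
    · exact notMem_of_mem_subclauses_extend hr rfl h
  rw [Finset.sum_congr rfl h1, Finset.sum_congr rfl h2, Finset.sum_congr rfl h3]
  simp

/-- Principle of deferred decisions: revealing only the new residual length leaves the residual
clause uniform. No restriction to one old length occurs here, since `Unif` already fixes it. -/
theorem Unif.step {N k : ℕ} {A : Assignment N} {l : Lit N} {s : Option ℕ} {μ : Clause N k → ℝ}
    (hμ : Unif A s μ) (hl : l ∈ unsetLits A) (s' : Option ℕ) :
    Unif (extend A {l}) s' (atResidual (extend A {l}) s' μ) := by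
  constructor
  · intro c hc
    unfold atResidual at hc
    split_ifs at hc with h
    · exact h
    · exact absurd rfl hc
  · rintro ℓ' rfl
    cases s with
    | none =>
      -- A satisfied clause stays satisfied, so nothing has a residual length and the constant is 0.
      refine ⟨0, fun f => ?_⟩
      rw [zero_mul]
      refine Finset.sum_eq_zero fun c _ => ?_
      unfold atResidual
      split_ifs with h
      · by_cases hc : μ c = 0
        · simp [hc]
        · rw [residual_extend_of_none hl (hμ.1 c hc)] at h
          cases h
      · simp
    | some ℓ =>
      obtain ⟨κ, hκ⟩ := hμ.2 ℓ rfl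
      have key : ∀ f : Finset (Lit N) → ℝ,
          ∑ c, atResidual (extend A {l}) (some ℓ') μ c * f (freeLits (extend A {l}) c)
          = ∑ c, μ c * (if l ∈ freeLits A c then 0 else
            (fun r => if r.card = ℓ' then f r else 0)
              ((freeLits A c).filter fun m => m.1 ≠ l.1)) := by
        intro f
        refine Finset.sum_congr rfl fun c _ => ?_
        by_cases hc : μ c = 0
        · simp [atResidual, hc]
        unfold atResidual
        by_cases hlc : l ∈ freeLits A c
        · simp [residual_extend_of_mem hl hlc, hlc]
        · simp only [residual_extend_of_notMem hl (hμ.1 c hc) hlc, if_neg hlc, freeLits_extend,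
            Option.some_inj, ite_mul, mul_ite, zero_mul, mul_zero]
      cases ℓ with
      | zero =>
        by_cases h0 : ℓ' = 0
        · refine ⟨κ, fun f => ?_⟩
          rw [key, h0, subclauses_zero,
            hκ fun r => if l ∈ r then 0 else
              (fun r => if r.card = 0 then f r else 0) (r.filter fun m => m.1 ≠ l.1),
            subclauses_zero]
          simp
        · refine ⟨0, fun f => ?_⟩
          rw [key, hκ fun r => if l ∈ r then 0 else
              (fun r => if r.card = ℓ' then f r else 0) (r.filter fun m => m.1 ≠ l.1),
            subclauses_zero]
          simp [Ne.symm h0]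
      | succ ℓ =>
        have h0 : ∀ (i : ℕ) (f : Finset (Lit N) → ℝ), ∑ r ∈ subclauses (extend A {l}) i,
            (if r.card = ℓ' then f r else 0)
            = (if i = ℓ' then 1 else 0) * ∑ r ∈ subclauses (extend A {l}) ℓ', f r := by
          intro i f
          split_ifs with h
          · subst h
            rw [one_mul]
            exact Finset.sum_congr rfl fun r hr => if_pos (mem_subclauses.1 hr).1.2
          · rw [zero_mul]
            refine Finset.sum_eq_zero fun r hr => if_neg ?_
            rw [(mem_subclauses.1 hr).1.2]
            exact h
        -- Length `ℓ'` is reached either by keeping all `ℓ + 1` literals or by losing one, and by no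
        -- other way.
        refine ⟨κ * ((if ℓ + 1 = ℓ' then 1 else 0) + (if ℓ = ℓ' then 1 else 0)), fun f => ?_⟩
        rw [key, sum_unsat_step hκ hl (fun r => if r.card = ℓ' then f r else 0), h0, h0]
        ring

/-- By uniformity each of the `2 * numUnset A` unset literals lies in the residual clause with the
same probability, and the clause has `ℓ` of them. -/
theorem Unif.sum_mem {N k : ℕ} {A : Assignment N} {l : Lit N} {ℓ : ℕ} {μ : Clause N k → ℝ}
    (hμ : Unif A (some ℓ) μ) (hl : l ∈ unsetLits A) :
    2 * (numUnset A : ℝ) * ∑ c, μ c * (if l ∈ freeLits A c then 1 else 0) = ℓ * ∑ c, μ c := by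
  obtain ⟨κ, hκ⟩ := hμ.2 ℓ rfl
  have h1 := hκ fun _ => 1
  simp only [mul_one, Finset.sum_const, nsmul_eq_mul] at h1
  rw [h1, hκ fun r => if l ∈ r then 1 else 0, ← Finset.sum_filter]
  cases ℓ with
  | zero => simp [subclauses_zero, Finset.filter_singleton]
  | succ ℓ =>
    rw [sum_subclauses_mem hl rfl]
    have := card_subclauses_extend hl ℓ
    simp only [Finset.sum_const, nsmul_eq_mul, mul_one]
    push_cast
    linear_combination κ * this

/-- The mean evolution of a clause when a literal is set. -/
theorem Unif.sum_residual {N k : ℕ} {A : Assignment N} {l : Lit N} {ℓ : ℕ} {μ : Clause N k → ℝ}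
    (hμ : Unif A (some ℓ) μ) (hl : l ∈ unsetLits A) (φ : Option ℕ → ℝ) :
    ∑ c, μ c * φ (residual (extend A {l}) c) = (∑ c, μ c) *
      ((1 - ℓ / numUnset A) * φ (some ℓ)
        + ℓ / (2 * numUnset A) * (φ none + φ (some (ℓ - 1)))) := by
  have hn : (numUnset A : ℝ) ≠ 0 := by
    have := numUnset_extend hl
    have : numUnset A ≠ 0 := by omega
    exact_mod_cast this
  have e1 := hμ.sum_mem hl
  have e2 := hμ.sum_mem (compl_mem_unsetLits hl)
  have key : ∀ c, μ c * φ (residual (extend A {l}) c) = φ (some ℓ) * μ c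
      + (φ none - φ (some ℓ)) * (μ c * (if l ∈ freeLits A c then 1 else 0))
      + (φ (some (ℓ - 1)) - φ (some ℓ)) *
        (μ c * (if Lit.compl l ∈ freeLits A c then 1 else 0)) := by
    intro c
    by_cases hc : μ c = 0
    · simp [hc]
    have hcons := (mem_subclauses.1 (freeLits_mem_subclauses A c)).2
    by_cases h1 : l ∈ freeLits A c
    · rw [residual_extend_of_mem hl h1, if_pos h1, if_neg (hcons.compl_notMem h1)]
      ring
    · have hcard := (residual_eq_some.1 (hμ.1 c hc)).2
      rw [residual_extend_of_notMem hl (hμ.1 c hc) h1, if_neg h1]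
      by_cases h2 : Lit.compl l ∈ freeLits A c
      · have : (freeLits A c).filter (fun m => m.1 ≠ l.1)
            = (freeLits A c).erase (Lit.compl l) := by
          ext m
          rw [Finset.mem_filter, Finset.mem_erase]
          refine ⟨fun h => ⟨fun h' => h.2 (by rw [h']; rfl), h.1⟩, fun h => ⟨h.2, fun h' => ?_⟩⟩
          rcases Lit.eq_or_eq_compl h' with rfl | h'
          · exact h1 h.2
          · exact h.1 h'
        rw [this, Finset.card_erase_of_mem h2, hcard, if_pos h2]
        ring
      · have : (freeLits A c).filter (fun m => m.1 ≠ l.1) = freeLits A c := by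
          rw [Finset.filter_eq_self]
          intro m hm h'
          rcases Lit.eq_or_eq_compl h' with rfl | rfl
          · exact h1 hm
          · exact h2 hm
        rw [this, hcard, if_neg h2]
        ring
  rw [Finset.sum_congr rfl fun c _ => key c, Finset.sum_add_distrib, Finset.sum_add_distrib,
    ← Finset.mul_sum, ← Finset.mul_sum, ← Finset.mul_sum]
  field_simp
  linear_combination (φ none - φ (some ℓ)) * e1 + (φ (some (ℓ - 1)) - φ (some ℓ)) * e2

theorem unif_const {N k : ℕ} : Unif (fun _ => none : Assignment N) (some k)
    (fun _ : Clause N k => 1) := by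
  have hfree : ∀ c : Clause N k, freeLits (fun _ => none) c = c.1 := by
    intro c
    ext l
    simp [mem_freeLits]
  constructor
  · intro c _
    rw [residual_eq_some, hfree]
    exact ⟨by simp, c.2.1⟩
  · intro ℓ hℓ
    rw [Option.some_inj] at hℓ
    subst hℓ
    refine ⟨1, fun f => ?_⟩
    rw [one_mul]
    refine Finset.sum_bij (fun c _ => c.1) ?_ ?_ ?_ ?_
    · intro c _
      rw [mem_subclauses]
      exact ⟨⟨fun l _ => by simp [mem_unsetLits], c.2.1⟩, c.2.2⟩
    · intro c _ c' _ h
      exact Subtype.ext h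
    · intro r hr
      rw [mem_subclauses] at hr
      exact ⟨⟨r, hr.1.2, hr.2⟩, Finset.mem_univ _, rfl⟩
    · intro c _
      rw [hfree, one_mul]

theorem card_clause (N k : ℕ) : Fintype.card (Clause N k) = N.choose k * 2 ^ k := by
  have h : (subclauses (fun _ => none : Assignment N) k).card = Fintype.card (Clause N k) := by
    rw [← Finset.card_univ]
    symm
    refine Finset.card_bij (fun c _ => c.1) ?_ ?_ ?_
    · intro c _
      rw [mem_subclauses]
      exact ⟨⟨fun l _ => by simp [mem_unsetLits], c.2.1⟩, c.2.2⟩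
    · intro c _ c' _ h
      exact Subtype.ext h
    · intro r hr
      rw [mem_subclauses] at hr
      exact ⟨⟨r, hr.1.2, hr.2⟩, Finset.mem_univ _, rfl⟩
  rw [← h, card_subclauses]
  simp [numUnset]

end Clauses

section Nodes

/-! ### Sums over the nodes of the search tree -/

open Classical in
/-- The expected value of the sum of `Φ` over the descendants at depth `T` of the node with
assignment `A`, where a node without clauses is split like any other. -/
def nodeSum {N M k : ℕ} (σ : UnitRule M) (F : Fin M → Clause N k)
    (Φ : List (Shape M) → Assignment N → ℝ) : ℕ → List (Shape M) → Assignment N → ℝ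
  | 0, h, A => Φ h A
  | T + 1, h, A =>
    if ∃ j, shape F A j = some 0 then 0
    else if hU : ∃ j, shape F A j = some 1 then
      ∑ j, (σ.pick h (shape F A) hU j).toReal *
        nodeSum σ F Φ T (shape F A :: h) (extend A (freeLits A (F j)))
    else (∑ l ∈ unsetLits A, (nodeSum σ F Φ T (shape F A :: h) (extend A {l}) +
      nodeSum σ F Φ T (shape F A :: h) (extend A {Lit.compl l}))) / (unsetLits A).card

/-- The mean of the weight `w` (of the last two residual lengths) of a clause of residual length
`s`, previously `x`, when `T` of the `n` unset variables have been assigned at random. -/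
def evolve (w : Option ℕ → Option ℕ → ℝ) : ℕ → ℕ → Option ℕ → Option ℕ → ℝ
  | 0, _, x, s => w x s
  | T + 1, n, _, none => evolve w T (n - 1) none none
  | T + 1, n, _, some ℓ => (1 - ℓ / n) * evolve w T (n - 1) (some ℓ) (some ℓ) +
      ℓ / (2 * n) * (evolve w T (n - 1) (some ℓ) none + evolve w T (n - 1) (some ℓ) (some (ℓ - 1)))

/-- Weights that do not tell unit propagation from splitting: a falsified clause weighs nothing,
and a 1-clause weighs half as much as a satisfied one. -/
structure Balanced (w : Option ℕ → Option ℕ → ℝ) : Prop where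
  dead : ∀ x, w x (some 0) = 0
  unit : ∀ T n x, 0 < n → 2 * evolve w (T + 1) n x (some 1) = evolve w T (n - 1) (some 1) none

theorem Balanced.evolve_dead {w : Option ℕ → Option ℕ → ℝ} (hw : Balanced w) (T n : ℕ)
    (x : Option ℕ) : evolve w T n x (some 0) = 0 := by
  induction T generalizing n x with
  | zero => exact hw.dead x
  | succ T ih => simp [evolve, ih]

/-- The residual length of clause `j` at the parent of the current node. -/
def prev {M : ℕ} : List (Shape M) → Fin M → Option ℕ
  | [], _ => none
  | s :: _, j => s j

theorem prod_update_mul {M : ℕ} {C : Type*} (μ : Fin M → C → ℝ) (k : Fin M) (q : C → ℝ)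
    (F : Fin M → C) :
    ∏ j, Function.update μ k (fun c => μ k c * q c) j (F j) = (∏ j, μ j (F j)) * q (F k) := by
  rw [← Finset.mul_prod_erase _ _ (Finset.mem_univ k),
    ← Finset.mul_prod_erase _ (fun j => μ j (F j)) (Finset.mem_univ k), Function.update_self]
  have : ∀ j ∈ Finset.univ.erase k,
      Function.update μ k (fun c => μ k c * q c) j (F j) = μ j (F j) := fun j hj => by
    rw [Function.update_of_ne (Finset.ne_of_mem_erase hj)]
  rw [Finset.prod_congr rfl this]
  ring

theorem sum_prod_mul {M : ℕ} {C : Type*} [Fintype C] (f : Fin M → C → ℝ) :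
    ∑ F : Fin M → C, ∏ j, f j (F j) = ∏ j, ∑ c, f j c := by
  rw [Finset.prod_univ_sum, Fintype.piFinset_univ]

open Classical in
theorem sum_atResidual {N k : ℕ} (A : Assignment N) (μ : Clause N k → ℝ) (c : Clause N k) :
    ∑ s ∈ Finset.univ.image (residual (k := k) A), atResidual A s μ c = μ c := by
  unfold atResidual
  rw [Finset.sum_ite_eq, if_pos (Finset.mem_image_of_mem _ (Finset.mem_univ _))]

open Classical in
theorem sum_mul_atResidual {N k : ℕ} (A : Assignment N) (μ : Clause N k → ℝ) (e : Option ℕ → ℝ) :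
    ∑ s ∈ Finset.univ.image (residual (k := k) A), e s * ∑ c, atResidual A s μ c
      = ∑ c, μ c * e (residual A c) := by
  simp_rw [Finset.mul_sum]
  rw [Finset.sum_comm]
  refine Finset.sum_congr rfl fun c _ => ?_
  unfold atResidual
  simp_rw [mul_ite, mul_zero]
  rw [Finset.sum_ite_eq, if_pos (Finset.mem_image_of_mem _ (Finset.mem_univ _)), mul_comm]

open Classical in
/-- An identity for weights that are carried by one residual shape extends to all weights whose
restrictions satisfy it. -/
theorem sum_prod_eq_of_atResidual {N M k : ℕ} {A : Assignment N} {ν : Fin M → Clause N k → ℝ}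
    {V : (Fin M → Clause N k) → ℝ} {e : Fin M → Option ℕ → ℝ} {θ : ℝ}
    (hV : ∀ p : Shape M, ∑ F, (∏ j, atResidual A (p j) (ν j) (F j)) * V F
      = θ * ∏ j, (e j (p j) * ∑ c, atResidual A (p j) (ν j) c)) :
    ∑ F, (∏ j, ν j (F j)) * V F = θ * ∏ j, ∑ c, ν j c * e j (residual A c) := by
  have h1 : ∀ F : Fin M → Clause N k, ∏ j, ν j (F j)
      = ∑ p ∈ Fintype.piFinset fun _ : Fin M => Finset.univ.image (residual (k := k) A),
        ∏ j, atResidual A (p j) (ν j) (F j) := by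
    intro F
    rw [← Finset.prod_univ_sum (fun _ : Fin M => Finset.univ.image (residual (k := k) A))
      (fun j s => atResidual A s (ν j) (F j))]
    exact Finset.prod_congr rfl fun j _ => (sum_atResidual A (ν j) (F j)).symm
  simp_rw [h1, Finset.sum_mul]
  rw [Finset.sum_comm]
  simp_rw [hV, ← Finset.mul_sum]
  rw [← Finset.prod_univ_sum (fun _ : Fin M => Finset.univ.image (residual (k := k) A))
      (fun j s => e j s * ∑ c, atResidual A s (ν j) c)]
  simp_rw [sum_mul_atResidual]

/-- The recursion of `evolve` is the transition of `Unif.sum_residual`, which does not depend on the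
literal that is set. -/
theorem Unif.sum_evolve {N k : ℕ} {A : Assignment N} {l : Lit N} {s : Option ℕ}
    {μ : Clause N k → ℝ} (hμ : Unif A s μ) (hl : l ∈ unsetLits A)
    (w : Option ℕ → Option ℕ → ℝ) (T : ℕ) (x : Option ℕ) :
    ∑ c, μ c * evolve w T (numUnset A - 1) s (residual (extend A {l}) c)
      = evolve w (T + 1) (numUnset A) x s * ∑ c, μ c := by
  cases s with
  | none =>
    rw [Finset.mul_sum]
    refine Finset.sum_congr rfl fun c _ => ?_
    by_cases hc : μ c = 0
    · simp [hc]
    · rw [residual_extend_of_none hl (hμ.1 c hc), evolve, mul_comm]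
  | some ℓ => rw [hμ.sum_residual hl, evolve, mul_comm]

theorem Unif.exists_freeLits {N k : ℕ} {A : Assignment N} {μ : Clause N k → ℝ}
    (hμ : Unif A (some 1) μ) {c : Clause N k} (hc : μ c ≠ 0) :
    ∃ l ∈ unsetLits A, freeLits A c = {l} := by
  obtain ⟨l, hl⟩ := Finset.card_eq_one.1 (residual_eq_some.1 (hμ.1 c hc)).2
  refine ⟨l, ?_, hl⟩
  have : l ∈ freeLits A c := by simp [hl]
  exact mem_unsetLits.2 (mem_freeLits.1 this).2

theorem sum_freeLits_eq {N k : ℕ} {A : Assignment N} {c : Clause N k} {l : Lit N}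
    (hl : l ∈ unsetLits A) (h : freeLits A c = {l}) (f : Lit N → ℝ) :
    ∑ m ∈ unsetLits A, (if freeLits A c = {m} then 1 else 0) * f m = f l := by
  rw [Finset.sum_eq_single l]
  · simp [h]
  · intro m _ hm
    rw [if_neg, zero_mul]
    rw [h, Finset.singleton_inj]
    exact hm.symm
  · exact fun h => absurd hl h

theorem sum_toReal_pick {M : ℕ} (p : PMF (Fin M)) : ∑ j, (p j).toReal = 1 := by
  rw [← ENNReal.toReal_sum fun j _ => p.apply_ne_top j, ← tsum_fintype (L := .unconditional _),
    p.tsum_coe, ENNReal.toReal_one]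

variable {N M k : ℕ} {σ : UnitRule M}
  {Φ : (Fin M → Clause N k) → List (Shape M) → Assignment N → ℝ}
  {w : Fin M → Option ℕ → Option ℕ → ℝ} {n₀ : ℕ} {θ : ℝ}

/-- The literal of the picked clause is uniform and independent of the other clauses. Once it is
fixed to `l`, the other clauses evolve as under any set literal, while clause `i` becomes satisfied;
`Balanced.unit` then yields the factor 2 that a second child would have given. -/
theorem sum_nodeSum_pick {T : ℕ} {h : List (Shape M)} {A : Assignment N} {s : Shape M}
    {μ : Fin M → Clause N k → ℝ}
    (ih : ∀ (h : List (Shape M)) (A : Assignment N) (s : Shape M) (μ : Fin M → Clause N k → ℝ),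
      (∀ j, Unif A (s j) (μ j)) → numUnset A = n₀ + T →
      ∑ F, (∏ j, μ j (F j)) * nodeSum σ F (Φ F) T h A
        = θ * 2 ^ T * ∏ j, (evolve (w j) T (n₀ + T) (prev h j) (s j) * ∑ c, μ j c))
    (hw : ∀ j, Balanced (w j)) (hμ : ∀ j, Unif A (s j) (μ j)) (hA : numUnset A = n₀ + (T + 1))
    {i : Fin M} (hi : s i = some 1) :
    ∑ F, (∏ j, μ j (F j)) * nodeSum σ F (Φ F) T (s :: h) (extend A (freeLits A (F i)))
      = θ * 2 ^ (T + 1) *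
        ∏ j, (evolve (w j) (T + 1) (n₀ + (T + 1)) (prev h j) (s j) * ∑ c, μ j c) := by
  have hμi := hμ i
  rw [hi] at hμi
  let q : Lit N → Clause N k → ℝ := fun l c => if freeLits A c = {l} then 1 else 0
  -- `ν l` keeps the instances in which the picked clause has been reduced to the literal `l`.
  let ν : Lit N → Fin M → Clause N k → ℝ :=
    fun l => Function.update μ i (fun c => μ i c * q l c)
  have h1 : ∀ F : Fin M → Clause N k,
      (∏ j, μ j (F j)) * nodeSum σ F (Φ F) T (s :: h) (extend A (freeLits A (F i)))
      = ∑ l ∈ unsetLits A, (∏ j, ν l j (F j)) *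
        nodeSum σ F (Φ F) T (s :: h) (extend A {l}) := by
    intro F
    simp_rw [ν, prod_update_mul, mul_assoc]
    rw [← Finset.mul_sum]
    by_cases hF : μ i (F i) = 0
    · rw [Finset.prod_eq_zero (Finset.mem_univ i) hF, zero_mul, zero_mul]
    · obtain ⟨l, hl, hl'⟩ := hμi.exists_freeLits hF
      rw [sum_freeLits_eq hl hl' (fun l => nodeSum σ F (Φ F) T (s :: h) (extend A {l})), hl']
  have hqn : ∀ l ∈ unsetLits A, ∀ c, μ i c * q l c ≠ 0 →
      residual (extend A {l}) c = none := by
    intro l hl c hc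
    refine residual_extend_of_mem hl ?_
    have : q l c ≠ 0 := right_ne_zero_of_mul hc
    simp only [q] at this
    split_ifs at this with h'
    · simp [h']
    · exact absurd rfl this
  have h2 : ∀ l ∈ unsetLits A, ∑ F, (∏ j, ν l j (F j)) *
        nodeSum σ F (Φ F) T (s :: h) (extend A {l})
      = θ * 2 ^ T * ((2 * evolve (w i) (T + 1) (n₀ + (T + 1)) (prev h i) (some 1) *
          ∑ c, μ i c * q l c) * ∏ j ∈ Finset.univ.erase i,
          (evolve (w j) (T + 1) (n₀ + (T + 1)) (prev h j) (s j) * ∑ c, μ j c)) := by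
    intro l hl
    have hA' : numUnset (extend A {l}) = n₀ + T := by
      have := numUnset_extend hl
      omega
    rw [sum_prod_eq_of_atResidual (A := extend A {l})
      (e := fun j => evolve (w j) T (n₀ + T) (prev (s :: h) j)) (θ := θ * 2 ^ T),
      ← Finset.mul_prod_erase _ _ (Finset.mem_univ i)]
    · congr 2
      · simp only [ν, Function.update_self]
        rw [(hw i).unit T (n₀ + (T + 1)) (prev h i) (by omega), Finset.mul_sum]
        refine Finset.sum_congr rfl fun c _ => ?_
        by_cases hc : μ i c * q l c = 0
        · simp [hc]
        · rw [hqn l hl c hc, mul_comm]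
          simp only [prev, hi]
          rfl
      · refine Finset.prod_congr rfl fun j hj => ?_
        simp only [ν, Function.update_of_ne (Finset.ne_of_mem_erase hj)]
        have := (hμ j).sum_evolve hl (w j) T (prev h j)
        rw [hA] at this
        exact this
    · intro p
      refine ih _ _ _ _ (fun j => ?_) hA'
      by_cases hj : j = i
      · subst hj
        simp only [ν, Function.update_self]
        constructor
        · intro c hc
          unfold atResidual at hc
          split_ifs at hc with h'
          · exact h'
          · exact absurd rfl hc
        · intro ℓ hℓ
          -- Clause `i` is satisfied for sure, so no weight is left at a length `ℓ`.
          refine ⟨0, fun f => ?_⟩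
          rw [zero_mul]
          refine Finset.sum_eq_zero fun c _ => ?_
          unfold atResidual
          split_ifs with h'
          · by_cases hc : μ j c * q l c = 0
            · simp only [hc, zero_mul]
            · rw [hqn l hl c hc, hℓ] at h'
              cases h'
          · rw [zero_mul]
      · simp only [ν, Function.update_of_ne hj]
        exact (hμ j).step hl (p j)
  have h3 : ∑ l ∈ unsetLits A, ∑ c, μ i c * q l c = ∑ c, μ i c := by
    rw [Finset.sum_comm]
    refine Finset.sum_congr rfl fun c _ => ?_
    by_cases hc : μ i c = 0
    · simp [hc]
    · obtain ⟨l, hl, hl'⟩ := hμi.exists_freeLits hc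
      have := sum_freeLits_eq hl hl' (fun _ => 1)
      simp only [mul_one] at this
      rw [← Finset.mul_sum, this, mul_one]
  rw [Finset.sum_congr rfl fun F _ => h1 F, Finset.sum_comm, Finset.sum_congr rfl h2,
    ← Finset.mul_sum, ← Finset.sum_mul, ← Finset.mul_sum, h3,
    ← Finset.mul_prod_erase Finset.univ (fun j => evolve (w j) (T + 1) (n₀ + (T + 1))
      (prev h j) (s j) * ∑ c, μ j c) (Finset.mem_univ i), hi]
  ring

theorem sum_nodeSum_split {T : ℕ} {h : List (Shape M)} {A : Assignment N} {s : Shape M}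
    {μ : Fin M → Clause N k → ℝ}
    (ih : ∀ (h : List (Shape M)) (A : Assignment N) (s : Shape M) (μ : Fin M → Clause N k → ℝ),
      (∀ j, Unif A (s j) (μ j)) → numUnset A = n₀ + T →
      ∑ F, (∏ j, μ j (F j)) * nodeSum σ F (Φ F) T h A
        = θ * 2 ^ T * ∏ j, (evolve (w j) T (n₀ + T) (prev h j) (s j) * ∑ c, μ j c))
    (hμ : ∀ j, Unif A (s j) (μ j)) (hA : numUnset A = n₀ + (T + 1))
    {l : Lit N} (hl : l ∈ unsetLits A) :
    ∑ F, (∏ j, μ j (F j)) * nodeSum σ F (Φ F) T (s :: h) (extend A {l})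
      = θ * 2 ^ T *
        ∏ j, (evolve (w j) (T + 1) (n₀ + (T + 1)) (prev h j) (s j) * ∑ c, μ j c) := by
  have hA' : numUnset (extend A {l}) = n₀ + T := by
    have := numUnset_extend hl
    omega
  rw [sum_prod_eq_of_atResidual (A := extend A {l})
    (e := fun j => evolve (w j) T (n₀ + T) (prev (s :: h) j)) (θ := θ * 2 ^ T)]
  · congr 1
    refine Finset.prod_congr rfl fun j _ => ?_
    have := (hμ j).sum_evolve hl (w j) T (prev h j)
    rw [hA] at this
    exact this
  · exact fun p => ih _ _ _ _ (fun j => (hμ j).step hl (p j)) hA'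

/-- Averaged over the instances, the sum over the nodes of a product of balanced weights of the
clauses factorizes, whatever the rule of unit propagation. -/
theorem sum_nodeSum (hw : ∀ j, Balanced (w j))
    (hΦ : ∀ (h : List (Shape M)) (A : Assignment N) (s : Shape M) (μ : Fin M → Clause N k → ℝ),
      (∀ j, Unif A (s j) (μ j)) → numUnset A = n₀ →
      ∑ F, (∏ j, μ j (F j)) * Φ F h A = θ * ∏ j, (w j (prev h j) (s j) * ∑ c, μ j c))
    (T : ℕ) (h : List (Shape M)) (A : Assignment N) (s : Shape M) (μ : Fin M → Clause N k → ℝ)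
    (hμ : ∀ j, Unif A (s j) (μ j)) (hA : numUnset A = n₀ + T) :
    ∑ F, (∏ j, μ j (F j)) * nodeSum σ F (Φ F) T h A
      = θ * 2 ^ T * ∏ j, (evolve (w j) T (n₀ + T) (prev h j) (s j) * ∑ c, μ j c) := by
  induction T generalizing h A s μ with
  | zero =>
    rw [pow_zero, mul_one]
    exact hΦ h A s μ hμ hA
  | succ T ih =>
    have hs : ∀ F : Fin M → Clause N k, ∏ j, μ j (F j) ≠ 0 → shape F A = s := by
      intro F hF
      funext j
      exact (hμ j).1 _ (Finset.prod_ne_zero_iff.1 hF j (Finset.mem_univ j))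
    -- A contradiction has no descendants, in agreement with the weight 0 of an empty clause.
    by_cases h0 : ∃ j, s j = some 0
    · obtain ⟨j, hj⟩ := h0
      rw [Finset.prod_eq_zero (Finset.mem_univ j) (by rw [hj, (hw j).evolve_dead, zero_mul]),
        mul_zero]
      refine Finset.sum_eq_zero fun F _ => ?_
      by_cases hF : ∏ j, μ j (F j) = 0
      · rw [hF, zero_mul]
      · rw [nodeSum, if_pos ⟨j, by rw [hs F hF, hj]⟩, mul_zero]
    -- On the support of the weight the shape is `s`, so the law of the pick is the same for all
    -- instances and can be taken out of the sum. This is where the ignorance of the literals is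
    -- used.
    by_cases h1 : ∃ j, s j = some 1
    · have e : ∀ F : Fin M → Clause N k, (∏ j, μ j (F j)) * nodeSum σ F (Φ F) (T + 1) h A
          = ∑ i, (σ.pick h s h1 i).toReal * ((∏ j, μ j (F j)) *
            nodeSum σ F (Φ F) T (s :: h) (extend A (freeLits A (F i)))) := by
        intro F
        by_cases hF : ∏ j, μ j (F j) = 0
        · simp [hF]
        · have := hs F hF
          subst this
          rw [nodeSum, if_neg h0, dif_pos h1, Finset.mul_sum]
          exact Finset.sum_congr rfl fun i _ => by ring
      rw [Finset.sum_congr rfl fun F _ => e F, Finset.sum_comm]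
      have e2 : ∀ i, ∑ F, (σ.pick h s h1 i).toReal * ((∏ j, μ j (F j)) *
            nodeSum σ F (Φ F) T (s :: h) (extend A (freeLits A (F i))))
          = (σ.pick h s h1 i).toReal * (θ * 2 ^ (T + 1) *
            ∏ j, (evolve (w j) (T + 1) (n₀ + (T + 1)) (prev h j) (s j) * ∑ c, μ j c)) := by
        intro i
        rw [← Finset.mul_sum]
        by_cases hi : σ.pick h s h1 i = 0
        · simp [hi]
        · rw [sum_nodeSum_pick ih hw hμ hA (σ.pick_unit h s h1 i ((PMF.mem_support_iff _ _).2 hi))]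
      rw [Finset.sum_congr rfl fun i _ => e2 i, ← Finset.sum_mul, sum_toReal_pick, one_mul]
    · have e : ∀ F : Fin M → Clause N k, (∏ j, μ j (F j)) * nodeSum σ F (Φ F) (T + 1) h A
          = (∑ l ∈ unsetLits A, ((∏ j, μ j (F j)) * nodeSum σ F (Φ F) T (s :: h) (extend A {l}) +
            (∏ j, μ j (F j)) * nodeSum σ F (Φ F) T (s :: h) (extend A {Lit.compl l}))) /
              (unsetLits A).card := by
        intro F
        by_cases hF : ∏ j, μ j (F j) = 0
        · simp [hF]
        · have := hs F hF
          subst this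
          rw [nodeSum, if_neg h0, dif_neg h1, ← mul_div_assoc, Finset.mul_sum]
          simp_rw [mul_add]
      have hc : ((unsetLits A).card : ℝ) ≠ 0 := by
        rw [card_unsetLits, hA]
        norm_cast
      rw [Finset.sum_congr rfl fun F _ => e F, ← Finset.sum_div, Finset.sum_comm,
        Finset.sum_congr rfl fun l hl => by
          rw [Finset.sum_add_distrib, sum_nodeSum_split ih hμ hA hl,
            sum_nodeSum_split ih hμ hA (compl_mem_unsetLits hl)],
        Finset.sum_const, nsmul_eq_mul, mul_div_assoc]
      field_simp
      ring

end Nodes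

/-! ### Sums over nodes and contradiction leaves -/

section Leaves

variable {N M k : ℕ} {σ : UnitRule M} {F : Fin M → Clause N k}
  {Φ Ψ : List (Shape M) → Assignment N → ℝ}

theorem nodeSum_mono (hΦ : ∀ h A, Φ h A ≤ Ψ h A) (T : ℕ) (h : List (Shape M))
    (A : Assignment N) : nodeSum σ F Φ T h A ≤ nodeSum σ F Ψ T h A := by
  induction T generalizing h A with
  | zero => exact hΦ h A
  | succ T ih =>
    simp only [nodeSum]
    split_ifs
    · exact le_rfl
    · exact Finset.sum_le_sum fun j _ => mul_le_mul_of_nonneg_left (ih _ _) ENNReal.toReal_nonneg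
    · exact div_le_div_of_nonneg_right
        (Finset.sum_le_sum fun l _ => add_le_add (ih _ _) (ih _ _)) (Nat.cast_nonneg _)

theorem nodeSum_nonneg (hΦ : ∀ h A, 0 ≤ Φ h A) (T : ℕ) (h : List (Shape M))
    (A : Assignment N) : 0 ≤ nodeSum σ F Φ T h A := by
  induction T generalizing h A with
  | zero => exact hΦ h A
  | succ T ih =>
    simp only [nodeSum]
    split_ifs
    · exact le_rfl
    · exact Finset.sum_nonneg fun j _ => mul_nonneg ENNReal.toReal_nonneg (ih _ _)
    · exact div_nonneg (Finset.sum_nonneg fun l _ => add_nonneg (ih _ _) (ih _ _))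
        (Nat.cast_nonneg _)

/-- Isolating the last level allows a contradiction to be detected from its parent. -/
theorem nodeSum_succ' (T : ℕ) (h : List (Shape M)) (A : Assignment N) :
    nodeSum σ F Φ (T + 1) h A = nodeSum σ F (nodeSum σ F Φ 1) T h A := by
  induction T generalizing h A with
  | zero => rfl
  | succ T ih =>
    rw [nodeSum, nodeSum]
    simp only [ih]

/-- Contradiction leaves are not more numerous than the branches created by the splittings. -/
theorem nodeSum_le_sum_split (hΨ : ∀ h A, Ψ h A ≤ 1) (hΦ : ∀ h A, 0 ≤ Φ h A)
    (hΦ' : ∀ h A, (¬ ∃ j, shape F A j = some 0) → (¬ ∃ j, shape F A j = some 1) → 1 ≤ Φ h A)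
    (T : ℕ) (h : List (Shape M)) (A : Assignment N) :
    nodeSum σ F Ψ T h A ≤ 1 + 2 * ∑ H ∈ Finset.range T, nodeSum σ F Φ H h A := by
  induction T generalizing h A with
  | zero => simpa [nodeSum] using hΨ h A
  | succ T ih =>
    rw [Finset.sum_range_succ', show nodeSum σ F Φ 0 h A = Φ h A from rfl]
    have hpos := hΦ h A
    by_cases h0 : ∃ j, shape F A j = some 0
    · rw [nodeSum, if_pos h0]
      have : 0 ≤ ∑ H ∈ Finset.range T, nodeSum σ F Φ (H + 1) h A :=
        Finset.sum_nonneg fun H _ => nodeSum_nonneg hΦ _ _ _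
      linarith
    by_cases h1 : ∃ j, shape F A j = some 1
    · rw [nodeSum, if_neg h0, dif_pos h1]
      have e : ∑ H ∈ Finset.range T, nodeSum σ F Φ (H + 1) h A
          = ∑ j, (σ.pick h (shape F A) h1 j).toReal * ∑ H ∈ Finset.range T,
            nodeSum σ F Φ H (shape F A :: h) (extend A (freeLits A (F j))) := by
        simp_rw [Finset.mul_sum]
        rw [Finset.sum_comm]
        refine Finset.sum_congr rfl fun H _ => ?_
        rw [nodeSum, if_neg h0, dif_pos h1]
      have e' : ∑ j, (σ.pick h (shape F A) h1 j).toReal *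
            nodeSum σ F Ψ T (shape F A :: h) (extend A (freeLits A (F j)))
          ≤ ∑ j, ((σ.pick h (shape F A) h1 j).toReal +
            2 * ((σ.pick h (shape F A) h1 j).toReal * ∑ H ∈ Finset.range T,
            nodeSum σ F Φ H (shape F A :: h) (extend A (freeLits A (F j))))) := by
        refine Finset.sum_le_sum fun j _ => ?_
        have := mul_le_mul_of_nonneg_left (ih (shape F A :: h) (extend A (freeLits A (F j))))
          (ENNReal.toReal_nonneg (a := σ.pick h (shape F A) h1 j))
        linarith
      rw [Finset.sum_add_distrib, ← Finset.mul_sum, ← e, sum_toReal_pick] at e'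
      linarith
    · rw [nodeSum, if_neg h0, dif_neg h1]
      have hc : (0 : ℝ) ≤ (unsetLits A).card := Nat.cast_nonneg _
      have e : ∑ H ∈ Finset.range T, nodeSum σ F Φ (H + 1) h A
          = (∑ l ∈ unsetLits A, ∑ H ∈ Finset.range T,
            (nodeSum σ F Φ H (shape F A :: h) (extend A {l}) +
              nodeSum σ F Φ H (shape F A :: h) (extend A {Lit.compl l}))) /
                (unsetLits A).card := by
        rw [Finset.sum_comm, Finset.sum_div]
        refine Finset.sum_congr rfl fun H _ => ?_
        rw [nodeSum, if_neg h0, dif_neg h1]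
      have e' : ∑ l ∈ unsetLits A, (nodeSum σ F Ψ T (shape F A :: h) (extend A {l}) +
            nodeSum σ F Ψ T (shape F A :: h) (extend A {Lit.compl l}))
          ≤ ∑ l ∈ unsetLits A, (2 + 2 * ∑ H ∈ Finset.range T,
            (nodeSum σ F Φ H (shape F A :: h) (extend A {l}) +
              nodeSum σ F Φ H (shape F A :: h) (extend A {Lit.compl l}))) := by
        refine Finset.sum_le_sum fun l _ => ?_
        have i1 := ih (shape F A :: h) (extend A {l})
        have i2 := ih (shape F A :: h) (extend A {Lit.compl l})
        rw [Finset.sum_add_distrib]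
        linarith
      rw [Finset.sum_add_distrib (f := fun _ => (2 : ℝ)), ← Finset.mul_sum, Finset.sum_const,
        nsmul_eq_mul] at e'
      have e3 := div_le_div_of_nonneg_right e' hc
      rw [add_div, mul_div_assoc 2, ← e] at e3
      -- Only an inequality: the quotient is 0 when no variable is unset.
      have e4 : ((unsetLits A).card : ℝ) * 2 / (unsetLits A).card ≤ 2 := by
        rw [mul_comm, mul_div_assoc]
        have := div_self_le_one ((unsetLits A).card : ℝ)
        linarith
      -- The splitting node itself, which is the term of height 0, pays for the extra branch.
      have := hΦ' h A h0 h1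
      linarith

/-! ### The law of the search tree -/

theorem tsum_bind_mul {α β : Type*} (p : PMF α) (f : α → PMF β) (g : β → ℝ≥0∞) :
    ∑' b, p.bind f b * g b = ∑' a, p a * ∑' b, f a b * g b := by
  simp_rw [PMF.bind_apply, ← ENNReal.tsum_mul_right, ← ENNReal.tsum_mul_left]
  rw [ENNReal.tsum_comm]
  simp_rw [mul_assoc]

theorem tsum_pure_mul {β : Type*} (b : β) (g : β → ℝ≥0∞) : ∑' x, PMF.pure b x * g x = g b := by
  rw [tsum_eq_single b]
  · simp
  · intro x hx
    simp [PMF.pure_apply, hx]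

theorem tsum_map_mul {α β : Type*} (p : PMF α) (f : α → β) (g : β → ℝ≥0∞) :
    ∑' b, p.map f b * g b = ∑' a, p a * g (f a) := by
  rw [PMF.map, tsum_bind_mul]
  simp_rw [Function.comp_apply, tsum_pure_mul]

open Classical in
/-- The indicator function of the nodes with a contradiction. -/
def contradictory (F : Fin M → Clause N k) (_ : List (Shape M)) (A : Assignment N) : ℝ :=
  if ∃ j, shape F A j = some 0 then 1 else 0

theorem contradictory_nonneg (F : Fin M → Clause N k) (h : List (Shape M)) (A : Assignment N) :
    0 ≤ contradictory F h A := by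
  unfold contradictory
  split_ifs <;> norm_num

theorem contradictory_le_one (F : Fin M → Clause N k) (h : List (Shape M)) (A : Assignment N) :
    contradictory F h A ≤ 1 := by
  unfold contradictory
  split_ifs <;> norm_num

/-- This makes it harmless that `nodeSum` goes on splitting below a solution leaf. -/
theorem nodeSum_contradictory_of_solution (T : ℕ) (h : List (Shape M)) {A : Assignment N}
    (hA : ∀ j, shape F A j = none) : nodeSum σ F (contradictory F) T h A = 0 := by
  induction T generalizing h A with
  | zero => simp [nodeSum, contradictory, hA]
  | succ T ih =>
    rw [nodeSum, if_neg (by simp [hA]), dif_neg (by simp [hA]), Finset.sum_eq_zero, zero_div]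
    intro l hl
    rw [ih _ fun j => residual_extend_of_none hl (hA j),
      ih _ fun j => residual_extend_of_none (compl_mem_unsetLits hl) (hA j), add_zero]

/-- The two recursions agree, expectation being linear. The bound `T < n` ensures that the procedure
still has fuel at height `T`. -/
theorem tsum_dpllUC {n T : ℕ} (hT : T < n) (h : List (Shape M)) (A : Assignment N) :
    ∑' τ, dpllUC σ F n h A τ * (τ.contradictionLeaves T : ℝ≥0∞)
      = ENNReal.ofReal (nodeSum σ F (contradictory F) T h A) := by
  have hnn : ∀ T h A, 0 ≤ nodeSum σ F (contradictory F) T h A := fun T h A =>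
    nodeSum_nonneg (contradictory_nonneg F) T h A
  induction n generalizing T h A with
  | zero => omega
  | succ n ih =>
    rw [dpllUC]
    split_ifs with hS hC hU
    · rw [tsum_pure_mul, nodeSum_contradictory_of_solution T h hS]
      simp [SearchTree.contradictionLeaves]
    · rw [tsum_pure_mul]
      cases T with
      | zero => simp [SearchTree.contradictionLeaves, nodeSum, contradictory, hC]
      | succ T => simp [SearchTree.contradictionLeaves, nodeSum, hC]
    · cases T with
      | zero =>
        rw [tsum_bind_mul]
        simp_rw [tsum_map_mul]
        simp [SearchTree.contradictionLeaves, nodeSum, contradictory, hC]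
      | succ T =>
        rw [tsum_bind_mul]
        simp_rw [tsum_map_mul, SearchTree.contradictionLeaves]
        simp_rw [ih (Nat.lt_of_succ_lt_succ hT)]
        rw [nodeSum, if_neg hC, dif_pos hU, tsum_fintype, ENNReal.ofReal_sum_of_nonneg
          fun j _ => mul_nonneg ENNReal.toReal_nonneg (hnn _ _ _)]
        refine Finset.sum_congr rfl fun j _ => ?_
        rw [ENNReal.ofReal_mul ENNReal.toReal_nonneg, ENNReal.ofReal_toReal (PMF.apply_ne_top _ _)]
    · rw [tsum_bind_mul]
      simp_rw [tsum_bind_mul, tsum_map_mul]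
      cases T with
      | zero => simp [SearchTree.contradictionLeaves, nodeSum, contradictory, hC]
      | succ T =>
        -- The leaves of the two subtrees add up; in each term the law of the other subtree sums to
        -- 1.
        simp_rw [SearchTree.contradictionLeaves, Nat.cast_add, mul_add, ENNReal.tsum_add,
          ENNReal.tsum_mul_right, PMF.tsum_coe, one_mul]
        simp_rw [mul_add, ENNReal.tsum_add, ENNReal.tsum_mul_right, PMF.tsum_coe, one_mul]
        simp_rw [ih (Nat.lt_of_succ_lt_succ hT)]
        rw [nodeSum, if_neg hC, dif_neg hU]
        have hc : 0 < (unsetLits A).card := Finset.card_pos.2 (unsetLits_nonempty hS hC)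
        rw [tsum_fintype,
          ENNReal.ofReal_div_of_pos (by exact_mod_cast hc),
          ENNReal.ofReal_sum_of_nonneg fun l _ => add_nonneg (hnn _ _ _) (hnn _ _ _),
          ENNReal.ofReal_natCast, div_eq_mul_inv, Finset.sum_mul,
          ← Finset.sum_subset (Finset.subset_univ (unsetLits A))]
        · refine Finset.sum_congr rfl fun l hl => ?_
          rw [PMF.uniformOfFinset_apply_of_mem _ hl, ENNReal.ofReal_add (hnn _ _ _) (hnn _ _ _),
            mul_comm]
        · intro l _ hl
          rw [PMF.uniformOfFinset_apply_of_notMem _ hl, zero_mul]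

theorem expectedLeaves_eq {T : ℕ} (hT : T < N) (F : Fin M → Clause N k) :
    expectedLeaves σ F T = nodeSum σ F (contradictory F) T [] (fun _ => none) := by
  rw [expectedLeaves, tsum_dpllUC hT,
    ENNReal.toReal_ofReal (nodeSum_nonneg (contradictory_nonneg F) _ _ _)]

/-! ### Instances with a repeated clause -/

/-- The rule of unit propagation for instances of `M'` clauses which a rule for `M` clauses
induces when some clauses are repeated. -/
def UnitRule.pull {M M' : ℕ} (σ : UnitRule M) (π : Fin M → Fin M')
    (hπ : Function.Surjective π) : UnitRule M' where
  pick h s hs := (σ.pick (h.map fun s => s ∘ π) (s ∘ π)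
    (hs.elim fun j hj => (hπ j).elim fun i hi => ⟨i, by simp [hi, hj]⟩)).map π
  pick_unit h s hs j hj := by
    rw [PMF.support_map] at hj
    obtain ⟨i, hi, rfl⟩ := hj
    exact σ.pick_unit _ _ _ i hi

theorem sum_toReal_map {α β : Type*} [Fintype α] [Fintype β] (p : PMF α) (f : α → β)
    (g : β → ℝ) : ∑ b, (p.map f b).toReal * g b = ∑ a, (p a).toReal * g (f a) := by
  classical
  have : ∀ b, (p.map f b).toReal = ∑ a, if b = f a then (p a).toReal else 0 := by
    intro b
    rw [PMF.map_apply, tsum_fintype, ENNReal.toReal_sum]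
    · refine Finset.sum_congr rfl fun a _ => ?_
      split_ifs <;> simp
    · intro a _
      split_ifs
      · exact p.apply_ne_top a
      · simp
  simp_rw [this, Finset.sum_mul]
  rw [Finset.sum_comm]
  refine Finset.sum_congr rfl fun a _ => ?_
  simp

/-- Repeating clauses changes neither which residual lengths occur nor the assignments reached, so
`G ∘ π` under `σ` has the same search as `G` under the pulled-back rule. -/
theorem nodeSum_comp_le {M' : ℕ} {π : Fin M → Fin M'} (hπ : Function.Surjective π)
    {G : Fin M' → Clause N k} {Φ' : List (Shape M') → Assignment N → ℝ}
    (hΦ : ∀ h A, Φ (h.map fun s => s ∘ π) A ≤ Φ' h A) (T : ℕ) (h : List (Shape M'))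
    (A : Assignment N) :
    nodeSum σ (G ∘ π) Φ T (h.map fun s => s ∘ π) A ≤ nodeSum (σ.pull π hπ) G Φ' T h A := by
  induction T generalizing h A with
  | zero => exact hΦ h A
  | succ T ih =>
    have hex : ∀ x, (∃ j, shape (G ∘ π) A j = some x) ↔ ∃ j, shape G A j = some x := by
      intro x
      constructor
      · rintro ⟨j, hj⟩
        exact ⟨π j, hj⟩
      · rintro ⟨j, hj⟩
        obtain ⟨i, rfl⟩ := hπ j
        exact ⟨i, hj⟩
    have hsh : shape (G ∘ π) A :: (h.map fun s => s ∘ π)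
        = (shape G A :: h).map fun s => s ∘ π := rfl
    simp only [nodeSum, hsh]
    by_cases h0 : ∃ j, shape G A j = some 0
    · rw [if_pos ((hex 0).2 h0), if_pos h0]
    by_cases h1 : ∃ j, shape G A j = some 1
    · rw [if_neg (mt (hex 0).1 h0), if_neg h0, dif_pos ((hex 1).2 h1), dif_pos h1]
      simp only [UnitRule.pull]
      rw [sum_toReal_map]
      exact Finset.sum_le_sum fun j _ =>
        mul_le_mul_of_nonneg_left (ih _ _) ENNReal.toReal_nonneg
    · rw [if_neg (mt (hex 0).1 h0), if_neg h0, dif_neg (mt (hex 1).1 h1), dif_neg h1]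
      exact div_le_div_of_nonneg_right
        (Finset.sum_le_sum fun l _ => add_le_add (ih _ _) (ih _ _)) (Nat.cast_nonneg _)

end Leaves

section Weights

/-! ### Weights of clauses -/

/-- The probability that a clause of residual length `s` survives if its last literal, when there
is only one, is set at random. -/
def liveWeight (_ : Option ℕ) : Option ℕ → ℝ
  | none => 1
  | some 0 => 0
  | some 1 => 1 / 2
  | some (_ + 2) => 1

/-- The indicator function of the clauses that have just become 1-clauses. -/
def newUnitWeight (x s : Option ℕ) : ℝ := if x = some 2 ∧ s = some 1 then 1 else 0

theorem liveWeight_nonneg (x s : Option ℕ) : 0 ≤ liveWeight x s := by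
  unfold liveWeight
  split <;> norm_num

theorem liveWeight_le_one (x s : Option ℕ) : liveWeight x s ≤ 1 := by
  unfold liveWeight
  split <;> norm_num

theorem newUnitWeight_nonneg (x s : Option ℕ) : 0 ≤ newUnitWeight x s := by
  unfold newUnitWeight
  split_ifs <;> norm_num

theorem newUnitWeight_le_one (x s : Option ℕ) : newUnitWeight x s ≤ 1 := by
  unfold newUnitWeight
  split_ifs <;> norm_num

theorem evolve_liveWeight_none (T n : ℕ) (x : Option ℕ) : evolve liveWeight T n x none = 1 := by
  induction T generalizing n x with
  | zero => rfl
  | succ T ih => rw [evolve, ih]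

theorem evolve_liveWeight_zero (T n : ℕ) (x : Option ℕ) :
    evolve liveWeight T n x (some 0) = 0 := by
  induction T generalizing n x with
  | zero => rfl
  | succ T ih => simp [evolve, ih]

/-- When its variable is set, a 1-clause goes to weight 1 or 0 with equal chances, so that 1/2 is
stationary. -/
theorem evolve_liveWeight_one (T n : ℕ) (x : Option ℕ) :
    evolve liveWeight T n x (some 1) = 1 / 2 := by
  induction T generalizing n x with
  | zero => rfl
  | succ T ih =>
    rw [evolve, ih, evolve_liveWeight_none, evolve_liveWeight_zero]
    push_cast
    ring

theorem evolve_liveWeight_two {T n : ℕ} (h : T + 2 ≤ n) (x : Option ℕ) :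
    evolve liveWeight T n x (some 2) = 1 - T * (2 * n - T - 1) / (4 * n * (n - 1)) := by
  induction T generalizing n x with
  | zero => simp [evolve, liveWeight]
  | succ T ih =>
    obtain ⟨n, rfl⟩ : ∃ m, n = m + 1 := ⟨n - 1, by omega⟩
    rw [evolve, Nat.add_sub_cancel, ih (by omega), evolve_liveWeight_none, evolve_liveWeight_one]
    have h2 : (2 : ℝ) ≤ n := by
      have : 2 ≤ n := by omega
      exact_mod_cast this
    have h0 : (n : ℝ) ≠ 0 := by positivity
    have h1 : (n : ℝ) - 1 ≠ 0 := by linarith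
    have h3 : (n : ℝ) + 1 ≠ 0 := by positivity
    push_cast
    rw [show (n : ℝ) + 1 - 1 = n by ring]
    field_simp
    ring

/-- The defect has two sources: three variables set and all literals false, with loss 1, and exactly
two set and both false, with loss 1/2. Both carry a factor 1/8, and the numbers of ordered choices
add up as `T(T-1)(T-2) + 3T(T-1)(n-T)`. -/
theorem evolve_liveWeight_three {T n : ℕ} (h : T + 3 ≤ n) (x : Option ℕ) :
    evolve liveWeight T n x (some 3)
      = 1 - T * (T - 1) * (3 * n - 2 * T - 2) / (8 * n * (n - 1) * (n - 2)) := by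
  induction T generalizing n x with
  | zero => simp [evolve, liveWeight]
  | succ T ih =>
    obtain ⟨n, rfl⟩ : ∃ m, n = m + 1 := ⟨n - 1, by omega⟩
    rw [evolve, Nat.add_sub_cancel, ih (by omega), evolve_liveWeight_none,
      evolve_liveWeight_two (by omega)]
    have h2 : (3 : ℝ) ≤ n := by
      have : 3 ≤ n := by omega
      exact_mod_cast this
    have h0 : (n : ℝ) ≠ 0 := by positivity
    have h1 : (n : ℝ) - 1 ≠ 0 := by linarith
    have h3 : (n : ℝ) + 1 ≠ 0 := by positivity
    have h4 : (n : ℝ) - 2 ≠ 0 := by linarith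
    push_cast
    rw [show (n : ℝ) + 1 - 1 = n by ring, show (n : ℝ) + 1 - 2 = n - 1 by ring]
    field_simp
    ring

theorem balanced_liveWeight : Balanced liveWeight where
  dead _ := rfl
  unit T n x _ := by
    rw [evolve_liveWeight_one, evolve_liveWeight_none]
    norm_num

theorem evolve_newUnitWeight_none (T n : ℕ) (x : Option ℕ) :
    evolve newUnitWeight T n x none = 0 := by
  induction T generalizing n x with
  | zero => simp [evolve, newUnitWeight]
  | succ T ih => rw [evolve, ih]

theorem evolve_newUnitWeight_zero (T n : ℕ) (x : Option ℕ) :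
    evolve newUnitWeight T n x (some 0) = 0 := by
  induction T generalizing n x with
  | zero => simp [evolve, newUnitWeight]
  | succ T ih => simp [evolve, ih]

/-- A 1-clause never becomes a new 1-clause again; only the case of no remaining step with previous
length 2 counts. -/
theorem evolve_newUnitWeight_one (T n : ℕ) {x : Option ℕ} (h : x ≠ some 2 ∨ T ≠ 0) :
    evolve newUnitWeight T n x (some 1) = 0 := by
  induction T generalizing n x with
  | zero =>
    have : x ≠ some 2 := by simpa using h
    simp [evolve, newUnitWeight, this]
  | succ T ih =>
    rw [evolve, ih _ (Or.inl (by simp)), evolve_newUnitWeight_none, evolve_newUnitWeight_zero]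
    ring

theorem evolve_newUnitWeight_two {T n : ℕ} (h : T + 3 ≤ n) (x : Option ℕ) :
    evolve newUnitWeight (T + 1) n x (some 2) = (n - T - 1) / (n * (n - 1)) := by
  induction T generalizing n x with
  | zero =>
    have h2 : (3 : ℝ) ≤ n := by
      have : 3 ≤ n := by omega
      exact_mod_cast this
    have h0 : (n : ℝ) ≠ 0 := by positivity
    have h1 : (n : ℝ) - 1 ≠ 0 := by linarith
    simp [evolve, newUnitWeight]
    field_simp
  | succ T ih =>
    obtain ⟨n, rfl⟩ : ∃ m, n = m + 1 := ⟨n - 1, by omega⟩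
    rw [evolve, Nat.add_sub_cancel, ih (by omega), evolve_newUnitWeight_none,
      evolve_newUnitWeight_one _ _ (Or.inr (by omega))]
    have h2 : (3 : ℝ) ≤ n := by
      have : 3 ≤ n := by omega
      exact_mod_cast this
    have h0 : (n : ℝ) ≠ 0 := by positivity
    have h1 : (n : ℝ) - 1 ≠ 0 := by linarith
    have h3 : (n : ℝ) + 1 ≠ 0 := by positivity
    push_cast
    rw [show (n : ℝ) + 1 - 1 = n by ring]
    field_simp
    ring

/-- One of the three variables is set at the very last step, another one among the `T` earlier
steps, the third remains unset: 6 ordered choices, times 1/4 for two false literals. -/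
theorem evolve_newUnitWeight_three {T n : ℕ} (h : T + 4 ≤ n) (x : Option ℕ) :
    evolve newUnitWeight (T + 1) n x (some 3)
      = 3 * T * (n - T - 1) / (2 * n * (n - 1) * (n - 2)) := by
  induction T generalizing n x with
  | zero => simp [evolve, newUnitWeight]
  | succ T ih =>
    obtain ⟨n, rfl⟩ : ∃ m, n = m + 1 := ⟨n - 1, by omega⟩
    rw [evolve, Nat.add_sub_cancel, ih (by omega), evolve_newUnitWeight_none,
      evolve_newUnitWeight_two (by omega)]
    have h2 : (3 : ℝ) ≤ n := by
      have : 3 ≤ n := by omega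
      exact_mod_cast this
    have h0 : (n : ℝ) ≠ 0 := by positivity
    have h1 : (n : ℝ) - 1 ≠ 0 := by linarith
    have h3 : (n : ℝ) + 1 ≠ 0 := by positivity
    have h4 : (n : ℝ) - 2 ≠ 0 := by linarith
    push_cast
    rw [show (n : ℝ) + 1 - 1 = n by ring, show (n : ℝ) + 1 - 2 = n - 1 by ring]
    field_simp
    ring

/-- Both sides vanish because only new 1-clauses count. The plain indicator of 1-clauses would not
be balanced. -/
theorem balanced_newUnitWeight : Balanced newUnitWeight where
  dead x := by simp [newUnitWeight]
  unit T n x _ := by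
    rw [evolve_newUnitWeight_one _ _ (Or.inr (by omega)), evolve_newUnitWeight_none, mul_zero]

variable {N M k : ℕ} {σ : UnitRule M} {F : Fin M → Clause N k}

/-- The weight of the clause `j`, when the clauses in `D` have to be new 1-clauses. -/
def clauseWeight (D : Finset (Fin M)) (j : Fin M) : Option ℕ → Option ℕ → ℝ :=
  if j ∈ D then newUnitWeight else liveWeight

/-- The weight of a node, when the clauses in `D` have to be new 1-clauses. -/
def nodeWeight (D : Finset (Fin M)) (F : Fin M → Clause N k) (h : List (Shape M))
    (A : Assignment N) : ℝ := ∏ j, clauseWeight D j (prev h j) (residual A (F j))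

theorem balanced_clauseWeight (D : Finset (Fin M)) (j : Fin M) : Balanced (clauseWeight D j) := by
  unfold clauseWeight
  split_ifs
  · exact balanced_newUnitWeight
  · exact balanced_liveWeight

theorem clauseWeight_nonneg (D : Finset (Fin M)) (j : Fin M) (x s : Option ℕ) :
    0 ≤ clauseWeight D j x s := by
  unfold clauseWeight
  split_ifs
  · exact newUnitWeight_nonneg x s
  · exact liveWeight_nonneg x s

theorem clauseWeight_le_one (D : Finset (Fin M)) (j : Fin M) (x s : Option ℕ) :
    clauseWeight D j x s ≤ 1 := by
  unfold clauseWeight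
  split_ifs
  · exact newUnitWeight_le_one x s
  · exact liveWeight_le_one x s

theorem nodeWeight_nonneg (D : Finset (Fin M)) (F : Fin M → Clause N k) (h : List (Shape M))
    (A : Assignment N) : 0 ≤ nodeWeight D F h A :=
  Finset.prod_nonneg fun j _ => clauseWeight_nonneg D j _ _

theorem nodeWeight_le_one (D : Finset (Fin M)) (F : Fin M → Clause N k) (h : List (Shape M))
    (A : Assignment N) : nodeWeight D F h A ≤ 1 :=
  Finset.prod_le_one (fun j _ => clauseWeight_nonneg D j _ _) fun j _ => clauseWeight_le_one D j _ _

theorem prod_evolve_clauseWeight (D : Finset (Fin M)) (T n : ℕ) (x s : Option ℕ) (K : ℝ) :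
    ∏ j, (evolve (clauseWeight D j) T n x s * K)
      = evolve newUnitWeight T n x s ^ D.card * evolve liveWeight T n x s ^ (M - D.card)
        * K ^ M := by
  have : ∀ j, evolve (clauseWeight D j) T n x s
      = if j ∈ D then evolve newUnitWeight T n x s else evolve liveWeight T n x s := by
    intro j
    unfold clauseWeight
    split_ifs <;> rfl
  simp_rw [Finset.prod_mul_distrib, this, Finset.prod_ite]
  simp only [Finset.prod_const, Finset.card_univ, Fintype.card_fin]
  rw [Finset.filter_mem_eq_inter, Finset.univ_inter, Finset.filter_not,
    Finset.card_sdiff_of_subset (Finset.filter_subset _ _), Finset.filter_mem_eq_inter,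
    Finset.univ_inter, Finset.card_univ, Fintype.card_fin]

theorem numUnset_empty : numUnset (fun _ => none : Assignment N) = N := by simp [numUnset]

/-- The form of `sum_nodeSum` for the procedure started with the empty assignment. -/
theorem sum_nodeSum_clauseWeight {Φ : (Fin M → Clause N k) → List (Shape M) → Assignment N → ℝ}
    {D : Finset (Fin M)} {T : ℕ} {θ : ℝ} (hT : T ≤ N)
    (hΦ : ∀ (h : List (Shape M)) (A : Assignment N) (s : Shape M) (μ : Fin M → Clause N k → ℝ),
      (∀ j, Unif A (s j) (μ j)) → numUnset A = N - T →
      ∑ F, (∏ j, μ j (F j)) * Φ F h A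
        = θ * ∏ j, (clauseWeight D j (prev h j) (s j) * ∑ c, μ j c)) :
    ∑ F, nodeSum σ F (Φ F) T [] (fun _ => none)
      = θ * 2 ^ T * (evolve newUnitWeight T N none (some k) ^ D.card *
        evolve liveWeight T N none (some k) ^ (M - D.card) * Fintype.card (Clause N k) ^ M) := by
  have := sum_nodeSum (σ := σ) (balanced_clauseWeight D) hΦ T [] (fun _ => none)
    (fun _ => some k) (fun _ _ => 1) (fun _ => unif_const) (by rw [numUnset_empty]; omega)
  simp only [Finset.prod_const_one, one_mul] at this
  rw [this, Nat.sub_add_cancel hT]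
  simp only [prev]
  rw [prod_evolve_clauseWeight]
  simp

theorem sum_prod_nodeWeight (D : Finset (Fin M)) (h : List (Shape M)) {A : Assignment N}
    {s : Shape M} {μ : Fin M → Clause N k → ℝ} (hμ : ∀ j, Unif A (s j) (μ j)) :
    ∑ F, (∏ j, μ j (F j)) * nodeWeight D F h A
      = ∏ j, (clauseWeight D j (prev h j) (s j) * ∑ c, μ j c) := by
  simp_rw [nodeWeight, ← Finset.prod_mul_distrib]
  rw [sum_prod_mul (fun j c => μ j c * clauseWeight D j (prev h j) (residual A c))]
  refine Finset.prod_congr rfl fun j _ => ?_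
  rw [Finset.mul_sum]
  refine Finset.sum_congr rfl fun c _ => ?_
  by_cases hc : μ j c = 0
  · simp [hc]
  · rw [(hμ j).1 c hc, mul_comm]

theorem sum_nodeSum_nodeWeight (D : Finset (Fin M)) {T : ℕ} (hT : T ≤ N) :
    ∑ F : Fin M → Clause N k, nodeSum σ F (nodeWeight D F) T [] (fun _ => none)
      = 2 ^ T * (evolve newUnitWeight T N none (some k) ^ D.card *
        evolve liveWeight T N none (some k) ^ (M - D.card) * Fintype.card (Clause N k) ^ M) := by
  have := sum_nodeSum_clauseWeight (σ := σ) (k := k) (D := D) (Φ := nodeWeight D) (θ := 1) hT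
    (fun h A s μ hμ _ => by rw [sum_prod_nodeWeight D h hμ, one_mul])
  rw [this, one_mul]

/-! ### Contradictions -/

/-- The two clauses are 1-clauses with opposite literals, if one of them is a 1-clause. -/
def Opposite (A : Assignment N) (c d : Clause N k) : Prop :=
  freeLits A c = (freeLits A d).image Lit.compl

open Classical in
/-- The probability that the 1-clause that is picked is opposite to `a`, or to `b` when `a` is
picked. -/
def pickOpposite (σ : UnitRule M) (a b : Fin M) (F : Fin M → Clause N k) (h : List (Shape M))
    (A : Assignment N) : ℝ :=
  if hU : ∃ j, shape F A j = some 1 then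
    ∑ i, (σ.pick h (shape F A) hU i).toReal *
      if Opposite A (F (if i = a then b else a)) (F i) then 1 else 0
  else 0

theorem pickOpposite_nonneg (a b : Fin M) (F : Fin M → Clause N k) (h : List (Shape M))
    (A : Assignment N) : 0 ≤ pickOpposite σ a b F h A := by
  unfold pickOpposite
  split_ifs
  · refine Finset.sum_nonneg fun i _ => mul_nonneg ENNReal.toReal_nonneg ?_
    by_cases hop : Opposite A (F (if i = a then b else a)) (F i)
    · rw [if_pos hop]
      exact zero_le_one
    · rw [if_neg hop]
  · exact le_rfl

theorem pickOpposite_le_one (a b : Fin M) (F : Fin M → Clause N k) (h : List (Shape M))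
    (A : Assignment N) : pickOpposite σ a b F h A ≤ 1 := by
  unfold pickOpposite
  split_ifs with hU
  · refine le_of_le_of_eq ?_ (sum_toReal_pick (σ.pick h (shape F A) hU))
    refine Finset.sum_le_sum fun i _ => mul_le_of_le_one_right ENNReal.toReal_nonneg ?_
    by_cases hop : Opposite A (F (if i = a then b else a)) (F i)
    · rw [if_pos hop]
    · rw [if_neg hop]
      exact zero_le_one
  · exact zero_le_one

theorem sum_prod_mul_eq {C : Type*} [Fintype C] {μ : Fin M → C → ℝ} {i : Fin M} {q : C → ℝ}
    {ρ : ℝ} (h : ∑ c, μ i c * q c = ρ * ∑ c, μ i c) :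
    ∑ F : Fin M → C, (∏ j, μ j (F j)) * q (F i) = ρ * ∑ F : Fin M → C, ∏ j, μ j (F j) := by
  simp_rw [← prod_update_mul, sum_prod_mul]
  rw [← Finset.mul_prod_erase _ _ (Finset.mem_univ i), Function.update_self, h,
    ← Finset.mul_prod_erase _ (fun j => ∑ c, μ j c) (Finset.mem_univ i), mul_assoc]
  congr 2
  refine Finset.prod_congr rfl fun j hj => ?_
  rw [Function.update_of_ne (Finset.ne_of_mem_erase hj)]

theorem Unif.sum_freeLits_eq {A : Assignment N} {μ : Clause N k → ℝ} (hμ : Unif A (some 1) μ)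
    {l : Lit N} (hl : l ∈ unsetLits A) :
    ∑ c, μ c * (if freeLits A c = {l} then 1 else 0) = 1 / (2 * numUnset A) * ∑ c, μ c := by
  have hn : (numUnset A : ℝ) ≠ 0 := by
    have := numUnset_extend hl
    have : numUnset A ≠ 0 := by omega
    exact_mod_cast this
  have h := hμ.sum_mem hl
  rw [Nat.cast_one, one_mul] at h
  rw [← h]
  field_simp
  refine Finset.sum_congr rfl fun c _ => ?_
  by_cases hc : μ c = 0
  · simp [hc]
  · obtain ⟨m, _, hm'⟩ := hμ.exists_freeLits hc
    rw [hm']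
    simp only [Finset.singleton_inj, Finset.mem_singleton, eq_comm]

-- The literals of two distinct 1-clauses are independent and uniform among the `2 * numUnset A`
-- unset ones, so they are complementary with the inverse probability.
open Classical in
theorem sum_opposite {A : Assignment N} {s : Shape M} {μ : Fin M → Clause N k → ℝ}
    (hμ : ∀ j, Unif A (s j) (μ j)) {i j : Fin M} (hij : i ≠ j) (hi : s i = some 1)
    (hj : s j = some 1) :
    ∑ F : Fin M → Clause N k, (∏ j, μ j (F j)) * (if Opposite A (F i) (F j) then 1 else 0)
      = 1 / (2 * numUnset A) * ∑ F : Fin M → Clause N k, ∏ j, μ j (F j) := by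
  have hμi := hμ i
  have hμj := hμ j
  rw [hi] at hμi
  rw [hj] at hμj
  let q : Lit N → Clause N k → ℝ := fun l c => if freeLits A c = {l} then 1 else 0
  have h1 : ∀ F : Fin M → Clause N k,
      (∏ j, μ j (F j)) * (if Opposite A (F i) (F j) then 1 else 0)
      = ∑ l ∈ unsetLits A, (∏ i, Function.update μ j (fun c => μ j c * q l c) i (F i)) *
        q (Lit.compl l) (F i) := by
    intro F
    simp_rw [prod_update_mul, mul_assoc]
    rw [← Finset.mul_sum]
    by_cases hF : μ j (F j) = 0
    · rw [Finset.prod_eq_zero (Finset.mem_univ j) hF, zero_mul, zero_mul]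
    · obtain ⟨l, hl, hl'⟩ := hμj.exists_freeLits hF
      rw [sum_freeLits_eq hl hl' (fun l => q (Lit.compl l) (F i))]
      simp only [Opposite, hl', Finset.image_singleton, q]
  have h2 : ∀ F : Fin M → Clause N k, ∏ j, μ j (F j)
      = ∑ l ∈ unsetLits A, (∏ i, Function.update μ j (fun c => μ j c * q l c) i (F i)) := by
    intro F
    simp_rw [prod_update_mul]
    rw [← Finset.mul_sum]
    by_cases hF : μ j (F j) = 0
    · rw [Finset.prod_eq_zero (Finset.mem_univ j) hF, zero_mul]
    · obtain ⟨l, hl, hl'⟩ := hμj.exists_freeLits hF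
      have := sum_freeLits_eq hl hl' (fun _ => 1)
      simp only [mul_one] at this
      rw [this, mul_one]
  rw [Finset.sum_congr rfl fun F _ => h1 F, Finset.sum_congr rfl fun F _ => h2 F,
    Finset.sum_comm, Finset.sum_comm (s := Finset.univ), Finset.mul_sum]
  refine Finset.sum_congr rfl fun l hl => ?_
  refine sum_prod_mul_eq ?_
  rw [Function.update_of_ne hij]
  exact hμi.sum_freeLits_eq (compl_mem_unsetLits hl)

theorem clauseWeight_eq_zero {D : Finset (Fin M)} {j : Fin M} (hj : j ∈ D) {x s : Option ℕ}
    (hs : s ≠ some 1) : clauseWeight D j x s = 0 := by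
  rw [clauseWeight, if_pos hj, newUnitWeight, if_neg fun h => hs h.2]

/-- Two marked clauses are needed because the rule may pick one of them: the clause compared with
the pick is always another 1-clause. The probability of opposition is therefore the same for every
pick, and the rule drops out. -/
theorem sum_nodeSum_pickOpposite {a b : Fin M} (hab : a ≠ b) {T : ℕ} (hT : T ≤ N) :
    ∑ F : Fin M → Clause N k, nodeSum σ F
        (fun h A => nodeWeight {a, b} F h A * pickOpposite σ a b F h A) T [] (fun _ => none)
      = 1 / (2 * (N - T : ℕ)) * 2 ^ T * (evolve newUnitWeight T N none (some k) ^ 2 *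
        evolve liveWeight T N none (some k) ^ (M - 2) * Fintype.card (Clause N k) ^ M) := by
  classical
  rw [← Finset.card_pair hab]
  refine sum_nodeSum_clauseWeight
    (Φ := fun F h A => nodeWeight {a, b} F h A * pickOpposite σ a b F h A) hT ?_
  intro h A s μ hμ hA
  have hs : ∀ F : Fin M → Clause N k, ∏ j, μ j (F j) ≠ 0 → shape F A = s := by
    intro F hF
    funext j
    exact (hμ j).1 _ (Finset.prod_ne_zero_iff.1 hF j (Finset.mem_univ j))
  by_cases hsab : s a = some 1 ∧ s b = some 1
  · have hU : ∃ j, s j = some 1 := ⟨a, hsab.1⟩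
    have e : ∀ F : Fin M → Clause N k, (∏ j, μ j (F j)) *
        (nodeWeight {a, b} F h A * pickOpposite σ a b F h A)
        = (∏ j, clauseWeight {a, b} j (prev h j) (s j)) * ∑ i, (σ.pick h s hU i).toReal *
          ((∏ j, μ j (F j)) *
            if Opposite A (F (if i = a then b else a)) (F i) then 1 else 0) := by
      intro F
      by_cases hF : ∏ j, μ j (F j) = 0
      · simp [hF]
      · have := hs F hF
        subst this
        rw [pickOpposite, dif_pos hU, nodeWeight, mul_left_comm, Finset.mul_sum]
        congr 1
        exact Finset.sum_congr rfl fun i _ => by ring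
    rw [Finset.sum_congr rfl fun F _ => e F, ← Finset.mul_sum, Finset.sum_comm,
      Finset.sum_congr rfl fun i _ => (Finset.mul_sum _ _ _).symm]
    have e2 : ∀ i, (σ.pick h s hU i).toReal * ∑ F : Fin M → Clause N k, ((∏ j, μ j (F j)) *
            if Opposite A (F (if i = a then b else a)) (F i) then 1 else 0)
        = (σ.pick h s hU i).toReal * (1 / (2 * (N - T : ℕ)) * ∏ j, ∑ c, μ j c) := by
      intro i
      by_cases hi : σ.pick h s hU i = 0
      · simp [hi]
      · rw [sum_opposite hμ _ _ (σ.pick_unit h s hU i ((PMF.mem_support_iff _ _).2 hi)), hA,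
          sum_prod_mul]
        · split_ifs with hia
          · rw [hia]; exact hab.symm
          · exact Ne.symm hia
        · split_ifs
          · exact hsab.2
          · exact hsab.1
    rw [Finset.sum_congr rfl fun i _ => e2 i, ← Finset.sum_mul, sum_toReal_pick,
      Finset.prod_mul_distrib]
    ring
  -- If `a` or `b` is not a 1-clause, its weight vanishes and so do both sides.
  · have h0 : ∏ j, clauseWeight {a, b} j (prev h j) (s j) = 0 := by
      rw [not_and_or] at hsab
      rcases hsab with h | h
      · exact Finset.prod_eq_zero (Finset.mem_univ a) (clauseWeight_eq_zero (by simp) h)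
      · exact Finset.prod_eq_zero (Finset.mem_univ b) (clauseWeight_eq_zero (by simp) h)
    rw [Finset.prod_mul_distrib, h0, zero_mul, mul_zero]
    refine Finset.sum_eq_zero fun F _ => ?_
    by_cases hF : ∏ j, μ j (F j) = 0
    · rw [hF, zero_mul]
    · have := hs F hF
      subst this
      rw [nodeWeight]
      change _ * ((∏ j, clauseWeight {a, b} j (prev h j) (shape F A j)) * _) = _
      rw [h0, zero_mul, mul_zero]

/-- Making the picked literal true empties the opposite 1-clause, whence a contradiction at the next
height. A nonzero weight rules out an earlier one and makes `a` and `b` 1-clauses. -/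
theorem nodeWeight_mul_pickOpposite_le (a b : Fin M) (F : Fin M → Clause N k)
    (h : List (Shape M)) (A : Assignment N) :
    nodeWeight {a, b} F h A * pickOpposite σ a b F h A
      ≤ nodeSum σ F (contradictory F) 1 h A := by
  classical
  by_cases h0 : nodeWeight {a, b} F h A = 0
  · rw [h0, zero_mul]
    exact nodeSum_nonneg (contradictory_nonneg F) _ _ _
  have hne := Finset.prod_ne_zero_iff.1 h0
  have hC : ¬ ∃ j, shape F A j = some 0 := by
    rintro ⟨j, hj⟩
    refine hne j (Finset.mem_univ j) ?_
    change residual A (F j) = some 0 at hj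
    rw [hj, (balanced_clauseWeight _ j).dead]
  have hD : ∀ j ∈ ({a, b} : Finset (Fin M)), residual A (F j) = some 1 := by
    intro j hj
    by_contra hj'
    exact hne j (Finset.mem_univ j) (clauseWeight_eq_zero hj hj')
  have hU : ∃ j, shape F A j = some 1 := ⟨a, hD a (by simp)⟩
  refine (mul_le_of_le_one_left (pickOpposite_nonneg a b F h A)
    (nodeWeight_le_one _ _ _ _)).trans ?_
  rw [nodeSum, if_neg hC, dif_pos hU, pickOpposite, dif_pos hU]
  refine Finset.sum_le_sum fun i _ => ?_
  by_cases hi : σ.pick h (shape F A) hU i = 0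
  · simp [hi]
  refine mul_le_mul_of_nonneg_left ?_ ENNReal.toReal_nonneg
  by_cases hop : Opposite A (F (if i = a then b else a)) (F i)
  · rw [if_pos hop]
    have hi1 := σ.pick_unit h _ hU i ((PMF.mem_support_iff _ _).2 hi)
    obtain ⟨l, hl⟩ := Finset.card_eq_one.1 (residual_eq_some.1 hi1).2
    set i' := if i = a then b else a with hi'
    have hi'1 : residual A (F i') = some 1 := hD _ (by rw [hi']; split_ifs <;> simp)
    have hlu : l ∈ unsetLits A := by
      have : l ∈ freeLits A (F i) := by simp [hl]
      exact mem_unsetLits.2 (mem_freeLits.1 this).2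
    rw [Opposite, hl, Finset.image_singleton] at hop
    rw [hl, nodeSum, contradictory, if_pos]
    refine ⟨i', ?_⟩
    change residual _ _ = _
    rw [residual_extend_of_notMem hlu hi'1 (by rw [hop]; simpa using (Lit.compl_ne l).symm), hop,
      Finset.filter_singleton, if_neg (by simp [Lit.compl])]
    simp
  · rw [if_neg hop]
    exact contradictory_nonneg _ _ _

end Weights

/-! ### The cost of distinct clauses, and bounds at finite size -/

section Repetitions

variable {N M k : ℕ}

/-- The map that identifies `j` with `j.succAbove i`. -/
def mergeMap (j : Fin (M + 1)) (i : Fin M) : Fin (M + 1) → Fin M :=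
  j.insertNth (α := fun _ => Fin M) i id

theorem mergeMap_self (j : Fin (M + 1)) (i : Fin M) : mergeMap j i j = i := by
  simp [mergeMap]

theorem mergeMap_succAbove (j : Fin (M + 1)) (i x : Fin M) :
    mergeMap j i (j.succAbove x) = x := by
  simp [mergeMap]

theorem mergeMap_surjective (j : Fin (M + 1)) (i : Fin M) :
    Function.Surjective (mergeMap j i) := fun x => ⟨j.succAbove x, mergeMap_succAbove j i x⟩

theorem comp_mergeMap {C : Type*} {j : Fin (M + 1)} {i : Fin M} {F : Fin (M + 1) → C}
    (h : F (j.succAbove i) = F j) : (F ∘ j.succAbove) ∘ mergeMap j i = F := by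
  funext x
  by_cases hx : x = j
  · subst hx
    simp [mergeMap_self, h]
  · obtain ⟨y, rfl⟩ := Fin.exists_succAbove_eq hx
    simp [mergeMap_succAbove]

/-- A map that identifies the two points is determined by its restriction to the complement of `j`.
-/
theorem sum_filter_eq_le {C : Type*} [Fintype C] [DecidableEq C] (j : Fin (M + 1)) (i : Fin M)
    {g : (Fin (M + 1) → C) → ℝ} (hg : ∀ F, 0 ≤ g F) :
    ∑ F with F (j.succAbove i) = F j, g F ≤ ∑ G : Fin M → C, g (G ∘ mergeMap j i) := by
  have h1 : ∑ F with F (j.succAbove i) = F j, g F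
      = ∑ F with F (j.succAbove i) = F j, g ((F ∘ j.succAbove) ∘ mergeMap j i) :=
    Finset.sum_congr rfl fun F hF => by rw [comp_mergeMap (Finset.mem_filter.1 hF).2]
  rw [h1, ← Finset.sum_image (f := fun G => g (G ∘ mergeMap j i))
    (g := fun F : Fin (M + 1) → C => F ∘ j.succAbove)]
  · exact Finset.sum_le_sum_of_subset_of_nonneg (Finset.subset_univ _) fun _ _ _ => hg _
  · intro F hF F' hF' h
    rw [← comp_mergeMap (Finset.mem_filter.1 hF).2, ← comp_mergeMap (Finset.mem_filter.1 hF').2]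
    exact congrArg (fun G : Fin M → C => G ∘ mergeMap j i) h

theorem prev_map_comp {M' : ℕ} (π : Fin M → Fin M') (h : List (Shape M')) (x : Fin M) :
    prev (h.map fun s => s ∘ π) x = prev h (π x) := by
  cases h <;> rfl

/-- The deleted clause `j` contributes a factor at most 1. -/
theorem nodeWeight_comp_le {j : Fin (M + 1)} {i : Fin M} {D : Finset (Fin (M + 1))}
    {D' : Finset (Fin M)} (hD : ∀ x, j.succAbove x ∈ D ↔ x ∈ D') (G : Fin M → Clause N k)
    (h : List (Shape M)) (A : Assignment N) :
    nodeWeight D (G ∘ mergeMap j i) (h.map fun s => s ∘ mergeMap j i) A ≤ nodeWeight D' G h A := by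
  rw [nodeWeight, Fin.prod_univ_succAbove _ j]
  refine (mul_le_of_le_one_left (Finset.prod_nonneg fun x _ => clauseWeight_nonneg _ _ _ _)
    (clauseWeight_le_one _ _ _ _)).trans (le_of_eq ?_)
  refine Finset.prod_congr rfl fun x _ => ?_
  rw [prev_map_comp, Function.comp_apply, mergeMap_succAbove]
  unfold clauseWeight
  simp only [hD]

theorem not_opposite_self {A : Assignment N} {c : Clause N k} (hc : residual A c = some 1) :
    ¬ Opposite A c c := by
  intro h
  obtain ⟨l, hl⟩ := Finset.card_eq_one.1 (residual_eq_some.1 hc).2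
  rw [Opposite, hl, Finset.image_singleton, Finset.singleton_inj] at h
  exact Lit.compl_ne l h.symm

theorem pickOpposite_comp_le {σ : UnitRule (M + 1)} {j : Fin (M + 1)} {i a b : Fin M}
    (G : Fin M → Clause N k) (h : List (Shape M)) (A : Assignment N) :
    pickOpposite σ (j.succAbove a) (j.succAbove b) (G ∘ mergeMap j i)
        (h.map fun s => s ∘ mergeMap j i) A
      ≤ pickOpposite (σ.pull _ (mergeMap_surjective j i)) a b G h A := by
  by_cases hU : ∃ x, shape (G ∘ mergeMap j i) A x = some 1
  · have hU' : ∃ x, shape G A x = some 1 := hU.elim fun x hx => ⟨mergeMap j i x, hx⟩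
    rw [pickOpposite, pickOpposite, dif_pos hU, dif_pos hU']
    simp only [UnitRule.pull]
    rw [sum_toReal_map]
    refine Finset.sum_le_sum fun x _ => ?_
    change (σ.pick _ (shape (G ∘ mergeMap j i) A) hU x).toReal * _
      ≤ (σ.pick _ (shape (G ∘ mergeMap j i) A) hU x).toReal * _
    by_cases hx0 : σ.pick (h.map fun s => s ∘ mergeMap j i) (shape (G ∘ mergeMap j i) A) hU x = 0
    · simp [hx0]
    refine mul_le_mul_of_nonneg_left ?_ ENNReal.toReal_nonneg
    have hx1 : residual A (G (mergeMap j i x)) = some 1 :=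
      σ.pick_unit _ _ hU x ((PMF.mem_support_iff _ _).2 hx0)
    simp only [Function.comp_apply]
    have himp : Opposite A
          (G (mergeMap j i (if x = j.succAbove a then j.succAbove b else j.succAbove a)))
          (G (mergeMap j i x)) →
        Opposite A (G (if mergeMap j i x = a then b else a)) (G (mergeMap j i x)) := by
      intro hop
      by_cases hxa : x = j.succAbove a
      · rw [hxa, if_pos rfl, mergeMap_succAbove, mergeMap_succAbove] at hop
        rwa [hxa, mergeMap_succAbove, if_pos rfl]
      · rw [if_neg hxa, mergeMap_succAbove] at hop
        by_cases hxa' : mergeMap j i x = a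
        -- Here the duplicate of `a` was picked: the opposition would be that of a 1-clause with
        -- itself. This case makes the lemma an inequality.
        · rw [hxa'] at hop hx1
          exact absurd hop (not_opposite_self hx1)
        · rwa [if_neg hxa']
    by_cases hop : Opposite A
          (G (mergeMap j i (if x = j.succAbove a then j.succAbove b else j.succAbove a)))
          (G (mergeMap j i x))
    · rw [if_pos hop, if_pos (himp hop)]
    · rw [if_neg hop]
      by_cases hop' : Opposite A (G (if mergeMap j i x = a then b else a)) (G (mergeMap j i x))
      · rw [if_pos hop']
        exact zero_le_one
      · rw [if_neg hop']
  · rw [pickOpposite, dif_neg hU]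
    exact pickOpposite_nonneg _ _ _ _ _

theorem mul_nodeWeight_nonneg {σ : UnitRule M} (D : Finset (Fin M)) (a b : Fin M)
    (F : Fin M → Clause N k) (h : List (Shape M)) (A : Assignment N) :
    0 ≤ nodeWeight D F h A * pickOpposite σ a b F h A :=
  mul_nonneg (nodeWeight_nonneg _ _ _ _) (pickOpposite_nonneg _ _ _ _ _)

/-- The expected weight of the instances in which the clauses `i` and `j` coincide. -/
theorem sum_repeated_le {σ : UnitRule (M + 1)} {a b i j : Fin (M + 1)} (hab : a ≠ b)
    (hij : i ≠ j) (hja : j ≠ a) (hjb : j ≠ b) {T : ℕ} (hT : T ≤ N) :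
    ∑ F : Fin (M + 1) → Clause N k with F i = F j, nodeSum σ F
        (fun h A => nodeWeight {a, b} F h A * pickOpposite σ a b F h A) T [] (fun _ => none)
      ≤ 1 / (2 * (N - T : ℕ)) * 2 ^ T * (evolve newUnitWeight T N none (some k) ^ 2 *
        evolve liveWeight T N none (some k) ^ (M - 2) * Fintype.card (Clause N k) ^ M) := by
  obtain ⟨i, rfl⟩ := Fin.exists_succAbove_eq hij
  obtain ⟨a, rfl⟩ := Fin.exists_succAbove_eq hja.symm
  obtain ⟨b, rfl⟩ := Fin.exists_succAbove_eq hjb.symm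
  have hab' : a ≠ b := fun h => hab (by rw [h])
  refine (sum_filter_eq_le j i fun F =>
    nodeSum_nonneg (mul_nodeWeight_nonneg _ _ _ F) _ _ _).trans ?_
  rw [← sum_nodeSum_pickOpposite (σ := σ.pull _ (mergeMap_surjective j i)) hab' hT]
  refine Finset.sum_le_sum fun G _ => ?_
  refine nodeSum_comp_le (mergeMap_surjective j i) (fun h A => ?_) T [] _
  refine mul_le_mul (nodeWeight_comp_le (fun x => ?_) G h A) (pickOpposite_comp_le G h A)
    (pickOpposite_nonneg _ _ _ _ _) (nodeWeight_nonneg _ _ _ _)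
  simp

/-- Merging the marked clauses leaves a single one, so the opposition is bounded by 1 and only one
factor of new 1-clause remains. The loss is compensated by the missing power of the number of
clauses. -/
theorem sum_repeated_pair_le {σ : UnitRule (M + 1)} {a b : Fin (M + 1)} (hab : a ≠ b)
    {T : ℕ} (hT : T ≤ N) :
    ∑ F : Fin (M + 1) → Clause N k with F a = F b, nodeSum σ F
        (fun h A => nodeWeight {a, b} F h A * pickOpposite σ a b F h A) T [] (fun _ => none)
      ≤ 2 ^ T * (evolve newUnitWeight T N none (some k) *
        evolve liveWeight T N none (some k) ^ (M - 1) * Fintype.card (Clause N k) ^ M) := by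
  obtain ⟨a, rfl⟩ := Fin.exists_succAbove_eq hab
  refine (sum_filter_eq_le b a fun F =>
    nodeSum_nonneg (mul_nodeWeight_nonneg _ _ _ F) _ _ _).trans ?_
  have := sum_nodeSum_nodeWeight (k := k) (σ := σ.pull _ (mergeMap_surjective b a)) {a} hT
  rw [Finset.card_singleton, pow_one] at this
  rw [← this]
  refine Finset.sum_le_sum fun G _ => ?_
  refine nodeSum_comp_le (mergeMap_surjective b a) (fun h A => ?_) T [] _
  refine (mul_le_of_le_one_right (nodeWeight_nonneg _ _ _ _)
    (pickOpposite_le_one _ _ _ _ _)).trans (nodeWeight_comp_le (fun x => ?_) G h A)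
  simp [Fin.succAbove_ne]

/-- A sum over all maps is at most the sum over the injective ones and over the maps that identify
two points, where all pairs but one are listed with their second point outside `{a, b}`. -/
theorem sum_le_sum_injective {C : Type*} [Fintype C] [DecidableEq C]
    [DecidablePred fun F : Fin M → C => Function.Injective F] {a b : Fin M}
    {g : (Fin M → C) → ℝ} (hg : ∀ F, 0 ≤ g F) :
    ∑ F, g F ≤ ∑ F with Function.Injective F, g F
      + ∑ p : Fin M × Fin M with p.1 ≠ p.2 ∧ p.2 ≠ a ∧ p.2 ≠ b, ∑ F with F p.1 = F p.2, g F
      + ∑ F with F a = F b, g F := by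
  set P : Finset (Fin M × Fin M) := Finset.univ.filter fun p => p.1 ≠ p.2 ∧ p.2 ≠ a ∧ p.2 ≠ b
  have h1 : ∀ F : Fin M → C, g F ≤ (if Function.Injective F then g F else 0)
      + ∑ p ∈ P, (if F p.1 = F p.2 then g F else 0) + (if F a = F b then g F else 0) := by
    intro F
    have hite : ∀ (p : Prop) [Decidable p], 0 ≤ if p then g F else 0 := by
      intro p _
      split_ifs
      · exact hg F
      · exact le_rfl
    have hs : 0 ≤ ∑ p ∈ P, (if F p.1 = F p.2 then g F else 0) :=
      Finset.sum_nonneg fun p _ => hite _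
    by_cases hF : Function.Injective F
    · rw [if_pos hF]
      have := hite (F a = F b)
      linarith
    have hsingle : ∀ p ∈ P, F p.1 = F p.2 →
        g F ≤ ∑ p ∈ P, (if F p.1 = F p.2 then g F else 0) := by
      intro p hp hFp
      have := Finset.single_le_sum (f := fun p : Fin M × Fin M =>
        if F p.1 = F p.2 then g F else 0) (fun p _ => hite _) hp
      simpa only [if_pos hFp] using this
    have h2 := hite (F a = F b)
    have h3 := hite (Function.Injective F)
    simp only [Function.Injective, not_forall] at hF
    obtain ⟨i, j, hFij, hij⟩ := hF
    by_cases hj : j ≠ a ∧ j ≠ b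
    · have := hsingle (i, j) (by simp only [P, Finset.mem_filter, Finset.mem_univ]; tauto) hFij
      linarith
    by_cases hi : i ≠ a ∧ i ≠ b
    · have := hsingle (j, i)
        (by simp only [P, Finset.mem_filter, Finset.mem_univ]; tauto) hFij.symm
      linarith
    have hFab : F a = F b := by
      rw [not_and_or, not_not, not_not] at hi hj
      rcases hi with rfl | rfl <;> rcases hj with rfl | rfl
      · exact absurd rfl hij
      · exact hFij
      · exact hFij.symm
      · exact absurd rfl hij
    rw [if_pos hFab]
    linarith
  refine (Finset.sum_le_sum fun F _ => h1 F).trans (le_of_eq ?_)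
  rw [Finset.sum_add_distrib, Finset.sum_add_distrib, Finset.sum_comm (t := P)]
  simp_rw [Finset.sum_filter]

theorem sum_embedding {C : Type*} [Fintype C] [Fintype (Fin M ↪ C)]
    [DecidablePred fun F : Fin M → C => Function.Injective F]
    (g : (Fin M → C) → ℝ) : ∑ F : Fin M ↪ C, g F = ∑ F with Function.Injective F, g F := by
  refine Finset.sum_bij (fun F _ => ⇑F) ?_ ?_ ?_ ?_
  · intro F _
    simpa using F.injective
  · intro F _ F' _ h
    exact DFunLike.coe_injective h
  · intro F hF
    exact ⟨⟨F, (Finset.mem_filter.1 hF).2⟩, Finset.mem_univ _, rfl⟩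
  · intro F _
    rfl

/-- The upper bound on the number of contradiction leaves. -/
theorem LC_le {σ : UnitRule M} {T : ℕ} (hT : T < N) :
    LC N M σ T ≤ (Fintype.card (Clause N 3) : ℝ) ^ M
        / ((Fintype.card (Clause N 3)).descFactorial M : ℕ) *
      (1 + 2 * ∑ H ∈ Finset.range T, 2 ^ H * evolve liveWeight H N none (some 3) ^ M) := by
  classical
  have hΦ' : ∀ (F : Fin M → Clause N 3) (h : List (Shape M)) (A : Assignment N),
      (¬ ∃ j, shape F A j = some 0) → (¬ ∃ j, shape F A j = some 1) → 1 ≤ nodeWeight ∅ F h A := by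
    intro F h A h0 h1
    refine le_of_eq (Finset.prod_eq_one fun j _ => ?_).symm
    rw [clauseWeight, if_neg (Finset.notMem_empty _)]
    have h0j : residual A (F j) ≠ some 0 := fun h => h0 ⟨j, h⟩
    have h1j : residual A (F j) ≠ some 1 := fun h => h1 ⟨j, h⟩
    generalize residual A (F j) = s at h0j h1j
    match s with
    | none => rfl
    | some 0 => exact absurd rfl h0j
    | some 1 => exact absurd rfl h1j
    | some (_ + 2) => rfl
  have hle : ∑ F : Fin M → Clause N 3, nodeSum σ F (contradictory F) T [] (fun _ => none)
      ≤ (Fintype.card (Clause N 3) : ℝ) ^ M *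
      (1 + 2 * ∑ H ∈ Finset.range T, 2 ^ H * evolve liveWeight H N none (some 3) ^ M) := by
    refine (Finset.sum_le_sum fun F _ => nodeSum_le_sum_split (contradictory_le_one F)
      (nodeWeight_nonneg ∅ F) (hΦ' F) T [] _).trans (le_of_eq ?_)
    rw [Finset.sum_add_distrib, ← Finset.mul_sum, Finset.sum_comm,
      Finset.sum_congr rfl fun H hH => sum_nodeSum_nodeWeight ∅
        ((Finset.mem_range.1 hH).le.trans hT.le)]
    simp only [Finset.card_empty, pow_zero, Nat.sub_zero, one_mul, Finset.sum_const,
      Finset.card_univ, Fintype.card_fun, Fintype.card_fin, nsmul_eq_mul, mul_one]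
    rw [mul_add, mul_one, Nat.cast_pow, Finset.mul_sum, Finset.mul_sum, Finset.mul_sum]
    congr 1
    exact Finset.sum_congr rfl fun H _ => by ring
  rw [LC]
  simp_rw [expectedLeaves_eq hT]
  rw [div_mul_eq_mul_div, Fintype.card_embedding_eq, Fintype.card_fin]
  refine div_le_div_of_nonneg_right (le_trans ?_ hle) (Nat.cast_nonneg _)
  rw [sum_embedding fun F : Fin M → Clause N 3 =>
    nodeSum σ F (contradictory F) T [] (fun _ => none)]
  exact Finset.sum_le_sum_of_subset_of_nonneg (Finset.subset_univ _) fun F _ _ =>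
    nodeSum_nonneg (contradictory_nonneg F) _ _ _

/-- The lower bound on the number of contradiction leaves. -/
theorem le_LC {σ : UnitRule (M + 1)} (hM : 1 ≤ M) {T : ℕ} (hT : T + 1 < N)
    (hK : M + 1 ≤ Fintype.card (Clause N 3)) {r u K : ℝ}
    (hr : r = evolve newUnitWeight T N none (some 3))
    (hu : u = evolve liveWeight T N none (some 3)) (hu0 : 0 ≤ u)
    (hKc : K = Fintype.card (Clause N 3)) :
    (1 / (2 * (N - T : ℕ)) * 2 ^ T * (r ^ 2 * u ^ (M + 1 - 2) * K ^ (M + 1))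
      - ((M + 1) ^ 2 * (1 / (2 * (N - T : ℕ)) * 2 ^ T * (r ^ 2 * u ^ (M - 2) * K ^ M))
        + 2 ^ T * (r * u ^ (M - 1) * K ^ M))) / K ^ (M + 1) ≤ LC N (M + 1) σ (T + 1) := by
  classical
  have hab : (0 : Fin (M + 1)) ≠ Fin.last M := by
    intro h
    have := congrArg Fin.val h
    simp at this
    omega
  set a : Fin (M + 1) := 0
  set b : Fin (M + 1) := Fin.last M
  let g : (Fin (M + 1) → Clause N 3) → ℝ := fun F => nodeSum σ F
    (fun h A => nodeWeight {a, b} F h A * pickOpposite σ a b F h A) T [] (fun _ => none)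
  have hg : ∀ F, 0 ≤ g F := fun F => nodeSum_nonneg (mul_nodeWeight_nonneg _ _ _ F) _ _ _
  have h1 := sum_le_sum_injective (a := a) (b := b) hg
  have h2 : ∑ F, g F = _ := sum_nodeSum_pickOpposite (σ := σ) hab (by omega : T ≤ N)
  have h3 : ∑ F with F a = F b, g F ≤ _ := sum_repeated_pair_le (σ := σ) hab (by omega : T ≤ N)
  rw [← hr, ← hu, ← hKc] at h2 h3
  set B : ℝ := 1 / (2 * (N - T : ℕ)) * 2 ^ T * (r ^ 2 * u ^ (M - 2) * K ^ M) with hB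
  have hB0 : 0 ≤ B := by
    have : 0 ≤ K := by rw [hKc]; exact Nat.cast_nonneg _
    positivity
  have h4 : ∑ p : Fin (M + 1) × Fin (M + 1) with p.1 ≠ p.2 ∧ p.2 ≠ a ∧ p.2 ≠ b,
      ∑ F with F p.1 = F p.2, g F ≤ (M + 1) ^ 2 * B := by
    refine (Finset.sum_le_card_nsmul _ _ B fun p hp => ?_).trans ?_
    · obtain ⟨hp1, hp2, hp3⟩ := (Finset.mem_filter.1 hp).2
      have := sum_repeated_le (k := 3) (σ := σ) hab hp1 hp2 hp3 (by omega : T ≤ N)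
      rw [← hr, ← hu, ← hKc] at this
      exact this
    · rw [nsmul_eq_mul]
      refine mul_le_mul_of_nonneg_right ?_ hB0
      refine (Nat.cast_le.2 (Finset.card_filter_le _ _)).trans (le_of_eq ?_)
      simp
      ring
  have h5 : ∑ F with Function.Injective F, g F
      ≤ ∑ F : Fin (M + 1) ↪ Clause N 3, expectedLeaves σ F (T + 1) := by
    simp_rw [expectedLeaves_eq hT]
    rw [sum_embedding fun F : Fin (M + 1) → Clause N 3 =>
      nodeSum σ F (contradictory F) (T + 1) [] (fun _ => none)]
    refine Finset.sum_le_sum fun F _ => ?_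
    -- The marked configuration at height `T` is the parent of a contradiction at height `T + 1`.
    rw [nodeSum_succ']
    exact nodeSum_mono (fun h A => nodeWeight_mul_pickOpposite_le a b F h A) _ _ _
  have hcard : (Fintype.card (Fin (M + 1) ↪ Clause N 3) : ℝ) ≤ K ^ (M + 1) := by
    rw [Fintype.card_embedding_eq, Fintype.card_fin, hKc]
    exact_mod_cast Nat.descFactorial_le_pow _ _
  have hcard0 : (0 : ℝ) < Fintype.card (Fin (M + 1) ↪ Clause N 3) := by
    rw [Fintype.card_embedding_eq, Fintype.card_fin]
    exact_mod_cast Nat.descFactorial_pos.2 hK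
  have h6 : 0 ≤ ∑ F : Fin (M + 1) ↪ Clause N 3, expectedLeaves σ F (T + 1) :=
    Finset.sum_nonneg fun F _ => ENNReal.toReal_nonneg
  rw [LC]
  refine le_trans ?_ (div_le_div_of_nonneg_left h6 hcard0 hcard)
  refine div_le_div_of_nonneg_right ?_ (hcard0.le.trans hcard)
  linarith

end Repetitions

section Asymptotics

open Filter

/-! ### Asymptotics -/

/-- The limit of the mean weight of a clause at height `t N`. -/
def survival (t : ℝ) : ℝ := 1 - 3 / 8 * t ^ 2 + 1 / 4 * t ^ 3

theorem Omega_three (t α : ℝ) : Omega t α 3 = t + α * Real.logb 2 (survival t) := by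
  rw [Omega, survival]
  norm_num

/-- The derivative is `-3/4 * t * (1 - t)`. -/
theorem survival_anti {s t : ℝ} (hs : 0 ≤ s) (hst : s ≤ t) (ht : t ≤ 1) :
    survival t ≤ survival s := by
  unfold survival
  nlinarith [mul_nonneg (sub_nonneg.2 hst) (mul_nonneg hs (sub_nonneg.2 ht)),
    mul_nonneg (sub_nonneg.2 hst) (mul_nonneg hs (sub_nonneg.2 (hst.trans ht))),
    mul_nonneg (sub_nonneg.2 hst) (mul_nonneg (hs.trans hst) (sub_nonneg.2 ht)),
    mul_nonneg (sub_nonneg.2 hst) (mul_nonneg (hs.trans hst) (sub_nonneg.2 (hst.trans ht))),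
    mul_nonneg (sub_nonneg.2 hst) hs, mul_nonneg (sub_nonneg.2 hst) (hs.trans hst)]

theorem le_survival {t : ℝ} (h0 : 0 ≤ t) (h1 : t ≤ 1) : 7 / 8 ≤ survival t := by
  have := survival_anti h0 h1 le_rfl
  refine le_trans (by norm_num [survival]) this

theorem survival_le_one {t : ℝ} (h0 : 0 ≤ t) (h1 : t ≤ 1) : survival t ≤ 1 := by
  have := survival_anti le_rfl h0 h1
  refine le_trans this (by norm_num [survival])

theorem Omega_three_le {t α : ℝ} (hα : 0 ≤ α) (h0 : 0 ≤ t) (h1 : t ≤ 1) :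
    Omega t α 3 ≤ 1 := by
  rw [Omega_three]
  have h2 : Real.logb 2 (survival t) ≤ 0 :=
    Real.logb_nonpos (by norm_num) (by linarith [le_survival h0 h1]) (survival_le_one h0 h1)
  nlinarith

/-- The slope of `survival` vanishes at 0, so between `h` and `ε` the logarithmic term loses at most
`2 α ε (ε - h)`, which the linear term outweighs when `ε ≤ 1 / (2 α)`. This lets the maximum over
`[ε, t]` control heights below `ε`. -/
theorem Omega_three_mono {α h ε : ℝ} (hα : 0 < α) (h0 : 0 ≤ h) (hh : h ≤ ε)
    (hε : ε ≤ 1) (hε' : ε ≤ 1 / (2 * α)) : Omega h α 3 ≤ Omega ε α 3 := by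
  rw [Omega_three, Omega_three]
  have hε0 := h0.trans hh
  have hqε := le_survival hε0 hε
  have hqh := le_survival h0 (hh.trans hε)
  have h1 := Real.one_sub_inv_le_log_of_pos (x := survival ε / survival h) (by positivity)
  rw [Real.log_div (by positivity) (by positivity), inv_div] at h1
  have h2 : survival h - survival ε ≤ 3 / 4 * ε * (ε - h) := by
    unfold survival
    nlinarith [mul_nonneg (sub_nonneg.2 hh) (mul_nonneg h0 hε0), mul_nonneg (sub_nonneg.2 hh)
      (sub_nonneg.2 hh), mul_nonneg (sub_nonneg.2 hh) (mul_nonneg h0 h0),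
      mul_nonneg (sub_nonneg.2 hh) (mul_nonneg hε0 hε0)]
  have h3 : survival h / survival ε - 1 ≤ 6 / 7 * ε * (ε - h) := by
    rw [div_sub_one (by positivity), div_le_iff₀ (by positivity)]
    nlinarith [mul_nonneg hε0 (sub_nonneg.2 hh)]
  have hl2 := Real.log_two_gt_d9
  -- The constant 2 is a rounding of `6 / (7 log 2)`.
  have h4 : -(2 * ε * (ε - h)) ≤ Real.logb 2 (survival ε) - Real.logb 2 (survival h) := by
    rw [Real.logb, Real.logb, ← sub_div, le_div_iff₀ (by positivity)]
    nlinarith [mul_nonneg hε0 (sub_nonneg.2 hh)]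
  have h5 : α * (2 * ε) ≤ 1 := by
    rw [le_div_iff₀ (by positivity)] at hε'
    linarith
  nlinarith [mul_le_mul_of_nonneg_left h4 hα.le, mul_nonneg (sub_nonneg.2 hh) (sub_nonneg.2 h5)]

/-- An error of order `1 / N` is what is needed: raised to a power `M` of order `N`, it costs a
bounded factor. -/
theorem abs_evolve_liveWeight_sub_le {H N : ℕ} (h : H + 3 ≤ N) (hN : 6 ≤ N) :
    |evolve liveWeight H N none (some 3) - survival (H / N)| ≤ 1 / N := by
  rw [evolve_liveWeight_three h, survival]
  have hN' : (6 : ℝ) ≤ N := by exact_mod_cast hN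
  have hH' : (H : ℝ) + 3 ≤ N := by exact_mod_cast h
  have hH0 : (0 : ℝ) ≤ H := Nat.cast_nonneg H
  have hHP : (0 : ℝ) ≤ H * (H - 1) := by
    rcases Nat.eq_zero_or_pos H with rfl | h1
    · simp
    · have : (1 : ℝ) ≤ H := by exact_mod_cast h1
      exact mul_nonneg hH0 (by linarith)
  generalize (N : ℝ) = n at *
  generalize (H : ℝ) = x at *
  have hn : 0 < n := by linarith
  have hD : n ^ 3 / 2 ≤ n * (n - 1) * (n - 2) := by nlinarith [mul_nonneg hn.le hn.le]
  have hD' : n * (n - 1) * (n - 2) ≤ n ^ 3 := by nlinarith [mul_nonneg hn.le hn.le]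
  have hDpos : 0 < n * (n - 1) * (n - 2) := lt_of_lt_of_le (by positivity) hD
  have hP0 : 0 ≤ x * (x - 1) * (3 * n - 2 * x - 2) := mul_nonneg hHP (by linarith)
  have hPQ : x * (x - 1) * (3 * n - 2 * x - 2) = x ^ 2 * (3 * n - 2 * x) - x * (3 * n - 2) := by
    ring
  have hQ0 : 0 ≤ x ^ 2 * (3 * n - 2 * x) := mul_nonneg (sq_nonneg x) (by linarith)
  have hQ1 : x ^ 2 * (3 * n - 2 * x) ≤ n ^ 3 := by
    nlinarith [mul_nonneg (sq_nonneg (n - x)) (by linarith : 0 ≤ n + 2 * x)]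
  have e1 : x * (x - 1) * (3 * n - 2 * x - 2) / (8 * n * (n - 1) * (n - 2))
      = x * (x - 1) * (3 * n - 2 * x - 2) / (n * (n - 1) * (n - 2)) / 8 := by
    rw [div_div]
    congr 1
    ring
  have e2 : 1 - 3 / 8 * (x / n) ^ 2 + 1 / 4 * (x / n) ^ 3
      = 1 - x ^ 2 * (3 * n - 2 * x) / n ^ 3 / 8 := by
    field_simp
    ring
  have b1 : x * (x - 1) * (3 * n - 2 * x - 2) / (n * (n - 1) * (n - 2))
      ≤ x ^ 2 * (3 * n - 2 * x) / n ^ 3 + 6 / n := by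
    have i1 : x * (x - 1) * (3 * n - 2 * x - 2) / (n * (n - 1) * (n - 2))
        ≤ x ^ 2 * (3 * n - 2 * x) / (n * (n - 1) * (n - 2)) := by
      refine div_le_div_of_nonneg_right ?_ hDpos.le
      rw [hPQ]
      have : 0 ≤ x * (3 * n - 2) := mul_nonneg hH0 (by linarith)
      linarith
    refine i1.trans ?_
    rw [div_le_iff₀ hDpos]
    have i2 : (x ^ 2 * (3 * n - 2 * x) / n ^ 3 + 6 / n) * (n * (n - 1) * (n - 2))
        - x ^ 2 * (3 * n - 2 * x)
        = 6 / n * (n * (n - 1) * (n - 2)) - x ^ 2 * (3 * n - 2 * x) / n ^ 3 *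
          (3 * n ^ 2 - 2 * n) := by
      field_simp
      ring
    have i3 : 3 * n ^ 2 ≤ 6 / n * (n * (n - 1) * (n - 2)) := by
      rw [div_mul_eq_mul_div, le_div_iff₀ hn]
      linarith
    have i4 : x ^ 2 * (3 * n - 2 * x) / n ^ 3 ≤ 1 := by
      rw [div_le_one (by positivity)]
      exact hQ1
    have i5 : x ^ 2 * (3 * n - 2 * x) / n ^ 3 * (3 * n ^ 2 - 2 * n) ≤ 3 * n ^ 2 - 2 * n :=
      mul_le_of_le_one_left (by nlinarith) i4
    linarith
  have b2 : x ^ 2 * (3 * n - 2 * x) / n ^ 3 - 6 / n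
      ≤ x * (x - 1) * (3 * n - 2 * x - 2) / (n * (n - 1) * (n - 2)) := by
    refine le_trans ?_ (div_le_div_of_nonneg_left hP0 hDpos hD')
    rw [hPQ, sub_div]
    have : x * (3 * n - 2) / n ^ 3 ≤ 6 / n := by
      rw [div_le_div_iff₀ (by positivity) hn]
      nlinarith [mul_nonneg hH0 hn.le, mul_nonneg (mul_nonneg hH0 hn.le) hn.le,
        mul_nonneg (mul_nonneg hn.le hn.le) (by linarith : 0 ≤ n - x)]
    linarith
  rw [e1, e2, abs_le]
  have e3 : 6 / n = 6 * (1 / n) := by ring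
  have e4 : 0 < 1 / n := by positivity
  rw [e3] at b1 b2
  constructor <;> linarith

theorem le_card_clause {N : ℕ} (hN : 6 ≤ N) :
    (N : ℝ) ^ 3 / 2 ≤ Fintype.card (Clause N 3) := by
  have hN' : (6 : ℝ) ≤ N := by exact_mod_cast hN
  rw [card_clause]
  push_cast
  rw [Nat.cast_choose_eq_descPochhammer_div]
  simp only [descPochhammer_succ_eval, descPochhammer_zero, Polynomial.eval_one]
  norm_num [Nat.factorial]
  nlinarith [mul_nonneg (by linarith : (0 : ℝ) ≤ N) (by linarith : (0 : ℝ) ≤ N)]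

theorem eventually_add_logb_le (a b : ℝ) {δ : ℝ} (hδ : 0 < δ) :
    ∀ᶠ N : ℕ in atTop, a + b * Real.logb 2 N ≤ δ * N := by
  have h1 : Tendsto (fun N : ℕ => a / (N : ℝ)) atTop (nhds 0) :=
    tendsto_const_div_atTop_nhds_zero_nat a
  have h2 : Tendsto (fun N : ℕ => Real.log (N : ℝ) / (N : ℝ)) atTop (nhds 0) :=
    (Real.isLittleO_log_id_atTop.tendsto_div_nhds_zero).comp tendsto_natCast_atTop_atTop
  have h3 : Tendsto (fun N : ℕ => a / (N : ℝ) + b / Real.log 2 * (Real.log (N : ℝ) / (N : ℝ)))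
      atTop (nhds 0) := by
    simpa using h1.add (h2.const_mul (b / Real.log 2))
  filter_upwards [h3.eventually (gt_mem_nhds hδ), eventually_gt_atTop 0] with N hN hN0
  have hN0' : (0 : ℝ) < N := by exact_mod_cast hN0
  have : a + b * Real.logb 2 N
      = (a / (N : ℝ) + b / Real.log 2 * (Real.log (N : ℝ) / (N : ℝ))) * N := by
    rw [Real.logb]
    field_simp
  rw [this]
  exact mul_le_mul_of_nonneg_right hN.le hN0'.le

theorem eventually_le_mul (a : ℝ) {c : ℝ} (hc : 0 < c) : ∀ᶠ N : ℕ in atTop, a ≤ c * N := by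
  simpa using eventually_add_logb_le a 0 hc

/-- The logarithm of the ratio of two numbers of `[1/2, 1]` at distance at most `1 / N`. -/
theorem log_sub_log_le {u v n : ℝ} (hv : 1 / 2 ≤ v) (hu : 1 / 2 ≤ u) (hn : 0 < n)
    (h : u - v ≤ 1 / n) : Real.log u - Real.log v ≤ 2 / n := by
  have hv0 : 0 < v := by linarith
  have hu0 : 0 < u := by linarith
  rw [← Real.log_div hu0.ne' hv0.ne']
  refine (Real.log_le_sub_one_of_pos (by positivity)).trans ?_
  rw [div_sub_one hv0.ne', div_le_iff₀ hv0]
  have : 1 / n ≤ 2 / n * v := by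
    rw [div_mul_eq_mul_div]
    exact div_le_div_of_nonneg_right (by linarith) hn.le
  linarith

/-- By `h1` and `h2` the two corrections for repeated clauses in `le_LC` are each at most a quarter
of the main term, so half of it survives. -/
theorem le_LC_of_large {N M m : ℕ} {σ : UnitRule M} (hM : 3 ≤ M) (hm : m + 1 < N)
    {r u K : ℝ} (hr : r = evolve newUnitWeight m N none (some 3))
    (hu : u = evolve liveWeight m N none (some 3)) (hKc : K = Fintype.card (Clause N 3))
    (hMK : (M : ℝ) ≤ K) (hr0 : 0 < r) (hu0 : 0 < u) (hu1 : u ≤ 1)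
    (h1 : 4 * (M : ℝ) ^ 2 ≤ K * u) (h2 : 8 * (N : ℝ) ≤ K * r) :
    2 ^ m * (r ^ 2 * u ^ M) / (4 * N) ≤ LC N M σ (m + 1) := by
  obtain ⟨M, rfl⟩ : ∃ M', M = M' + 3 := ⟨M - 3, by omega⟩
  have hK0 : 0 < K := lt_of_lt_of_le (by positivity) hMK
  have hMK' : M + 3 ≤ Fintype.card (Clause N 3) := by
    rw [hKc] at hMK
    exact_mod_cast hMK
  refine le_trans ?_ (le_LC (M := M + 2) (σ := σ) (by omega) hm hMK' hr hu hu0.le hKc)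
  have hn0 : (0 : ℝ) < (N - m : ℕ) := by
    have : 0 < N - m := by omega
    exact_mod_cast this
  have hnN : ((N - m : ℕ) : ℝ) ≤ N := by exact_mod_cast Nat.sub_le N m
  have hN0 : (0 : ℝ) < N := lt_of_lt_of_le hn0 hnN
  generalize ((N - m : ℕ) : ℝ) = n at *
  rw [le_div_iff₀ (by positivity), show M + 2 + 1 - 2 = M + 1 by omega,
    show M + 2 - 2 = M by omega, show M + 2 - 1 = M + 1 by omega]
  -- With `X` factored out, the main term is `u * K`, and the corrections are the squared number of
  -- clauses and `2 * n * u / r`.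
  set X : ℝ := 2 ^ m * r ^ 2 * u ^ M * K ^ (M + 2) / (2 * n) with hX
  have hX0 : 0 < X := by positivity
  have e1 : 1 / (2 * n) * 2 ^ m * (r ^ 2 * u ^ (M + 1) * K ^ (M + 2 + 1)) = X * (u * K) := by
    rw [hX]
    field_simp
    ring
  have e2 : 1 / (2 * n) * 2 ^ m * (r ^ 2 * u ^ M * K ^ (M + 2)) = X := by
    rw [hX]
    field_simp
  have e3 : 2 ^ m * (r * u ^ (M + 1) * K ^ (M + 2)) = X * (2 * n * u / r) := by
    rw [hX]
    field_simp
    ring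
  have e4 : 2 ^ m * (r ^ 2 * u ^ (M + 3)) / (4 * N) * K ^ (M + 2 + 1)
      = X * (u * K * (u ^ 2 * (n / N) / 2)) := by
    rw [hX]
    field_simp
    ring
  rw [e1, e2, e3, e4]
  have i1 : 2 * n * u / r ≤ u * K / 4 := by
    rw [div_le_div_iff₀ hr0 (by norm_num)]
    nlinarith [mul_le_mul_of_nonneg_left h2 hu0.le, mul_le_mul_of_nonneg_left hnN hu0.le]
  have i2 : u * K * (u ^ 2 * (n / N) / 2) ≤ u * K * (1 / 2) := by
    refine mul_le_mul_of_nonneg_left ?_ (by positivity)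
    have : u ^ 2 * (n / N) ≤ 1 :=
      mul_le_one₀ (pow_le_one₀ hu0.le hu1) (by positivity) ((div_le_one hN0).2 hnN)
    linarith
  have i3 : ((M + 2 : ℕ) + 1 : ℝ) ^ 2 = ((M + 3 : ℕ) : ℝ) ^ 2 := by
    push_cast
    ring
  have i4 : u * K * (u ^ 2 * (n / N) / 2)
      ≤ u * K - (((M + 2 : ℕ) + 1 : ℝ) ^ 2 + 2 * n * u / r) := by
    rw [i3]
    linarith
  have := mul_le_mul_of_nonneg_left i4 hX0.le
  linarith

theorem evolve_liveWeight_bounds {H N : ℕ} (h : H + 3 ≤ N) (hN : 6 ≤ N) :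
    1 / 2 ≤ evolve liveWeight H N none (some 3) ∧ evolve liveWeight H N none (some 3) ≤ 1 := by
  have hN' : (6 : ℝ) ≤ N := by exact_mod_cast hN
  have hH' : (H : ℝ) + 3 ≤ N := by exact_mod_cast h
  have hH0 : (0 : ℝ) ≤ H := Nat.cast_nonneg H
  constructor
  · have h1 := (abs_le.1 (abs_evolve_liveWeight_sub_le h hN)).1
    have h2 := le_survival (t := H / N) (by positivity) ((div_le_one (by linarith)).2 (by linarith))
    have h3 : (1 : ℝ) / N ≤ 1 / 6 := one_div_le_one_div_of_le (by norm_num) hN'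
    linarith
  · rw [evolve_liveWeight_three h]
    have hHP : (0 : ℝ) ≤ H * (H - 1) := by
      rcases Nat.eq_zero_or_pos H with rfl | h1
      · simp
      · have : (1 : ℝ) ≤ H := by exact_mod_cast h1
        exact mul_nonneg hH0 (by linarith)
    have : 0 ≤ (H : ℝ) * (H - 1) * (3 * N - 2 * H - 2) / (8 * N * (N - 1) * (N - 2)) :=
      div_nonneg (mul_nonneg hHP (by linarith))
        (mul_nonneg (mul_nonneg (by linarith) (by linarith)) (by linarith))
    linarith

/-- Away from heights 0 and `N`, the numbers of set and of unset variables are both of order `N`, so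
the chance of becoming a 1-clause at a given step is of order `1 / N`. -/
theorem le_evolve_newUnitWeight {m N : ℕ} {ε : ℝ} (hε : 0 < ε) (hmN : m + 1 + 3 ≤ N)
    (hN6 : 6 ≤ N) (hmlow : ε * N / 2 ≤ m) (hmup : ε * N ≤ N - m - 1) :
    ε ^ 2 / (2 * N) ≤ evolve newUnitWeight (m + 1) N none (some 3) := by
  have hN : (6 : ℝ) ≤ N := by exact_mod_cast hN6
  have hN0 : (0 : ℝ) < N := by linarith
  have h1 : 3 * (ε * N / 2) * (ε * N) ≤ 3 * m * (N - m - 1) :=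
    mul_le_mul (by linarith) hmup (by positivity) (by positivity)
  have h2 : (0 : ℝ) < 2 * N * (N - 1) * (N - 2) :=
    mul_pos (mul_pos (by linarith) (by linarith)) (by linarith)
  rw [evolve_newUnitWeight_three (by omega), div_le_div_iff₀ (by positivity) h2]
  have h3 : (2 : ℝ) * N * (N - 1) * (N - 2) ≤ 2 * N ^ 3 := by nlinarith
  have h4 : ε ^ 2 * (2 * N * (N - 1) * (N - 2)) ≤ ε ^ 2 * (2 * N ^ 3) :=
    mul_le_mul_of_nonneg_left h3 (by positivity)
  have h5 := mul_le_mul_of_nonneg_right h1 (by positivity : (0 : ℝ) ≤ 2 * N)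
  have h6 : ε ^ 2 * (2 * (N : ℝ) ^ 3) ≤ 3 * (ε * N / 2) * (ε * N) * (2 * N) := by
    have : 0 ≤ ε ^ 2 * (N : ℝ) ^ 3 := by positivity
    nlinarith
  linarith

theorem logb_survival_le {α t : ℝ} {m M N : ℕ} (hα : 0 < α) (ht0 : 0 ≤ t) (hN6 : 6 ≤ N)
    (hmN : m + 1 + 3 ≤ N) (hmt : (m : ℝ) + 1 ≤ t * N) (ht1 : t ≤ 1) (hM : (M : ℝ) ≤ α * N) :
    α * Real.logb 2 (survival t) * N - 4 * α
      ≤ M * Real.logb 2 (evolve liveWeight (m + 1) N none (some 3)) := by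
  have hN : (6 : ℝ) ≤ N := by exact_mod_cast hN6
  have hN0 : (0 : ℝ) < N := by linarith
  have hud := abs_le.1 (abs_evolve_liveWeight_sub_le (H := m + 1) hmN hN6)
  obtain ⟨hu2, hu1⟩ := evolve_liveWeight_bounds (H := m + 1) hmN hN6
  generalize evolve liveWeight (m + 1) N none (some 3) = u at *
  have hu0 : 0 < u := by linarith
  have hq := le_survival ht0 ht1
  have hqm : survival t ≤ survival ((m + 1 : ℕ) / N) :=
    survival_anti (by positivity)
      (by rw [div_le_iff₀ hN0]; push_cast; linarith) ht1
  have hlog := log_sub_log_le (u := survival t) (v := u) (n := N) hu2 (by linarith) hN0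
    (by linarith [hud.1])
  have hl2 : (1 : ℝ) / 2 < Real.log 2 := by linarith [Real.log_two_gt_d9]
  have hlogb : Real.logb 2 (survival t) - Real.logb 2 u ≤ 4 / N := by
    rw [Real.logb, Real.logb, ← sub_div, div_le_iff₀ (by linarith)]
    refine hlog.trans ?_
    have : (2 : ℝ) / N = 4 / N * (1 / 2) := by ring
    rw [this]
    exact mul_le_mul_of_nonneg_left hl2.le (by positivity)
  have hlu : Real.logb 2 u ≤ 0 := Real.logb_nonpos (by norm_num) hu0.le hu1
  have h1 : α * N * Real.logb 2 u ≤ M * Real.logb 2 u := mul_le_mul_of_nonpos_right hM hlu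
  have h2 : α * N * (Real.logb 2 (survival t) - Real.logb 2 u) ≤ 4 * α := by
    refine (mul_le_mul_of_nonneg_left hlogb (by positivity)).trans (le_of_eq ?_)
    field_simp
  linarith

theorem eventually_le_logb_LC {α ε δ : ℝ} (hα : 0 < α) (hε : 0 < ε) (hδ : 0 < δ) :
    ∀ᶠ N : ℕ in atTop, ∀ σ : UnitRule ⌊α * (N : ℝ)⌋₊, ∀ t ∈ Set.Icc ε (1 - ε),
      0 < LC N ⌊α * (N : ℝ)⌋₊ σ ⌊t * (N : ℝ)⌋₊ ∧
      (Omega t α 3 - δ) * N ≤ Real.logb 2 (LC N ⌊α * (N : ℝ)⌋₊ σ ⌊t * (N : ℝ)⌋₊) := by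
  -- The thresholds `16 α²`, `32 / ε²` and `2 α` give respectively `4 M² ≤ K u`, `8 N ≤ K r` and `M
  -- ≤ K`. The last condition absorbs the rounding of the height (2), the error on the weights (`4
  -- α`) and the polynomial factor `ε ^ 4 / (16 N ^ 3)`.
  filter_upwards [eventually_ge_atTop 6, eventually_le_mul 6 hε, eventually_le_mul 3 hα,
    eventually_le_mul (16 * α ^ 2) one_pos, eventually_le_mul (32 / ε ^ 2) one_pos,
    eventually_le_mul (2 * α) one_pos,
    eventually_add_logb_le (2 + 4 * α - Real.logb 2 (ε ^ 4 / 16)) 3 hδ]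
    with N hN6 hNε hNα hN1 hN2 hN4 hN3 σ t ht
  have hN : (6 : ℝ) ≤ N := by exact_mod_cast hN6
  have hN0 : (0 : ℝ) < N := by linarith
  rw [one_mul] at hN1 hN2 hN4
  have ht0 : 0 < t := hε.trans_le ht.1
  have ht1 : t ≤ 1 := by linarith [ht.2]
  have hεt : ε * N ≤ t * N := mul_le_mul_of_nonneg_right ht.1 hN0.le
  have htε : t * N ≤ (1 - ε) * N := mul_le_mul_of_nonneg_right ht.2 hN0.le
  have hT := Nat.floor_le (mul_nonneg ht0.le hN0.le)
  have hT' := Nat.lt_floor_add_one (t * (N : ℝ))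
  have hT6 : 6 ≤ ⌊t * (N : ℝ)⌋₊ := Nat.le_floor (by push_cast; linarith)
  have hM := Nat.floor_le (mul_nonneg hα.le hN0.le)
  have hM3 : 3 ≤ ⌊α * (N : ℝ)⌋₊ := Nat.le_floor (by push_cast; linarith)
  -- One unit for the step from the parent to the leaf, one for the last step in the formula for new
  -- 1-clauses.
  obtain ⟨m, hm⟩ : ∃ m, ⌊t * (N : ℝ)⌋₊ = m + 1 + 1 := ⟨⌊t * (N : ℝ)⌋₊ - 2, by omega⟩
  rw [hm] at hT hT' ⊢
  push_cast at hT hT'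
  generalize ⌊α * (N : ℝ)⌋₊ = M at *
  have hmN : m + 1 + 3 ≤ N := by
    have : (m : ℝ) + 1 + 3 ≤ N := by linarith
    exact_mod_cast this
  have hm0 : (0 : ℝ) ≤ m := Nat.cast_nonneg m
  have hmlow : ε * N / 2 ≤ m := by linarith
  have hmup : ε * N ≤ N - m - 1 := by linarith
  have hK := le_card_clause hN6
  set K : ℝ := (Fintype.card (Clause N 3) : ℝ) with hKc
  set r := evolve newUnitWeight (m + 1) N none (some 3) with hr
  obtain ⟨hu2, hu1⟩ := evolve_liveWeight_bounds (H := m + 1) hmN hN6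
  set u := evolve liveWeight (m + 1) N none (some 3) with hu
  have hu0 : 0 < u := by linarith
  have hrlow : ε ^ 2 / (2 * N) ≤ r := le_evolve_newUnitWeight hε hmN hN6 hmlow hmup
  have hr0 : 0 < r := lt_of_lt_of_le (by positivity) hrlow
  have hMsq : (M : ℝ) ^ 2 ≤ α ^ 2 * N ^ 2 := by
    rw [← mul_pow]
    exact pow_le_pow_left₀ (Nat.cast_nonneg _) hM 2
  have hN3' : (16 * α ^ 2) * (N : ℝ) ^ 2 ≤ N ^ 3 := by
    rw [pow_succ (N : ℝ) 2, mul_comm ((N : ℝ) ^ 2)]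
    exact mul_le_mul_of_nonneg_right hN1 (by positivity)
  have hKu : 4 * (M : ℝ) ^ 2 ≤ K * u := by
    have : (N : ℝ) ^ 3 / 2 * (1 / 2) ≤ K * u :=
      mul_le_mul hK hu2 (by norm_num) (by positivity)
    linarith
  have hKr : 8 * (N : ℝ) ≤ K * r := by
    have h1 : (N : ℝ) ^ 3 / 2 * (ε ^ 2 / (2 * N)) ≤ K * r :=
      mul_le_mul hK hrlow (by positivity) (by positivity)
    rw [div_le_iff₀ (by positivity)] at hN2
    have h2 : (N : ℝ) ^ 3 / 2 * (ε ^ 2 / (2 * N)) = N * (N * ε ^ 2) / 4 := by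
      field_simp
      norm_num
    rw [h2] at h1
    have := mul_le_mul_of_nonneg_left hN2 hN0.le
    linarith
  have hMK : (M : ℝ) ≤ K := by
    have h1 : α * N ≤ N ^ 3 / 2 := by
      nlinarith [mul_nonneg hN0.le hN0.le, mul_le_mul_of_nonneg_right hN4 hN0.le,
        mul_nonneg (mul_nonneg hN0.le hN0.le) (by linarith : (0 : ℝ) ≤ N - 1)]
    linarith
  have hLC := le_LC_of_large (σ := σ) hM3 (m := m + 1) (by omega) hr hu hKc hMK hr0 hu0 hu1 hKu hKr
  have hlow : 2 ^ (m + 1) * u ^ M * (ε ^ 4 / 16) / N ^ 3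
      ≤ 2 ^ (m + 1) * (r ^ 2 * u ^ M) / (4 * N) := by
    have h1 : (ε ^ 2 / (2 * N)) ^ 2 ≤ r ^ 2 := pow_le_pow_left₀ (by positivity) hrlow 2
    have h2 : 2 ^ (m + 1) * u ^ M * (ε ^ 4 / 16) / N ^ 3
        = 2 ^ (m + 1) * ((ε ^ 2 / (2 * N)) ^ 2 * u ^ M) / (4 * N) := by
      field_simp
      norm_num
    rw [h2]
    gcongr
  have hpos : 0 < 2 ^ (m + 1) * u ^ M * (ε ^ 4 / 16) / (N : ℝ) ^ 3 := by positivity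
  refine ⟨hpos.trans_le (hlow.trans hLC), le_trans ?_
    (Real.logb_le_logb_of_le (by norm_num) hpos (hlow.trans hLC))⟩
  rw [Real.logb_div (by positivity) (by positivity), Real.logb_mul (by positivity) (by positivity),
    Real.logb_mul (by positivity) (by positivity), Real.logb_pow, Real.logb_pow, Real.logb_pow,
    Real.logb_self_eq_one (by norm_num), Omega_three]
  have := logb_survival_le (α := α) hα ht0.le hN6 hmN (by linarith : (m : ℝ) + 1 ≤ t * N) ht1 hM
  push_cast
  nlinarith

/-- Birthday bound: by Bernoulli's inequality the proportion of injections is at least `1 - M (M -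
1) / K`. -/
theorem pow_le_two_mul_descFactorial {K M : ℕ} (hM : 1 ≤ M) (h : 2 * M ^ 2 ≤ K) :
    (K : ℝ) ^ M / (K.descFactorial M : ℕ) ≤ 2 := by
  have hM2 : M ≤ M ^ 2 := Nat.le_self_pow (by norm_num) M
  have hMK : M ≤ K := by omega
  have hK0 : (0 : ℝ) < K := by
    have : 0 < K := by omega
    exact_mod_cast this
  rw [div_le_iff₀ (by exact_mod_cast Nat.descFactorial_pos.2 hMK)]
  have h1 : ((K + 1 - M : ℕ) : ℝ) ^ M ≤ (K.descFactorial M : ℕ) := by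
    exact_mod_cast Nat.pow_sub_le_descFactorial K M
  have h2 : ((K + 1 - M : ℕ) : ℝ) = K * (1 + -((M - 1) / K)) := by
    rw [Nat.cast_sub (by omega)]
    push_cast
    field_simp
    ring
  have hM1 : (1 : ℝ) ≤ M := by exact_mod_cast hM
  have hMK' : (M : ℝ) ≤ K := by exact_mod_cast hMK
  have h' : 2 * (M : ℝ) ^ 2 ≤ K := by exact_mod_cast h
  have h4 : ((M : ℝ) - 1) / K ≤ 1 := by
    rw [div_le_one hK0]
    linarith
  have h3 := one_add_mul_le_pow (a := -(((M : ℝ) - 1) / K)) (by linarith) M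
  have h5 : (1 : ℝ) / 2 ≤ 1 + M * -((M - 1) / K) := by
    have : M * (((M : ℝ) - 1) / K) ≤ 1 / 2 := by
      rw [← mul_div_assoc, div_le_iff₀ hK0]
      nlinarith
    linarith
  rw [h2, mul_pow] at h1
  have h6 := mul_le_mul_of_nonneg_left (h5.trans h3) (by positivity : (0 : ℝ) ≤ (K : ℝ) ^ M)
  linarith

theorem eventually_logb_LC_le {α ε δ : ℝ} (hα : 0 < α) (hε : 0 < ε) (hε' : ε < 1 / (2 * α))
    (hδ : 0 < δ) :
    ∀ᶠ N : ℕ in atTop, ∀ σ : UnitRule ⌊α * (N : ℝ)⌋₊, ∀ t ∈ Set.Icc ε (1 - ε),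
      0 < LC N ⌊α * (N : ℝ)⌋₊ σ ⌊t * (N : ℝ)⌋₊ →
      Real.logb 2 (LC N ⌊α * (N : ℝ)⌋₊ σ ⌊t * (N : ℝ)⌋₊) ≤
        (sSup ((fun h : ℝ => Omega h α 3) '' Set.Icc ε t) + δ) * N := by
  filter_upwards [eventually_ge_atTop 6, eventually_le_mul 6 hε, eventually_le_mul 3 hα,
    eventually_le_mul (16 * α ^ 2) one_pos,
    eventually_add_logb_le (4 * α + 4) 1 hδ]
    with N hN6 hNε hNα hN1 hN3 σ t ht hLC0
  have hN : (6 : ℝ) ≤ N := by exact_mod_cast hN6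
  have hN0 : (0 : ℝ) < N := by linarith
  rw [one_mul] at hN1 hN3
  have ht0 : 0 < t := hε.trans_le ht.1
  have ht1 : t ≤ 1 := by linarith [ht.2]
  have hεt : ε * N ≤ t * N := mul_le_mul_of_nonneg_right ht.1 hN0.le
  have htε : t * N ≤ (1 - ε) * N := mul_le_mul_of_nonneg_right ht.2 hN0.le
  have hT := Nat.floor_le (mul_nonneg ht0.le hN0.le)
  have hM := Nat.floor_le (mul_nonneg hα.le hN0.le)
  have hM' := Nat.lt_floor_add_one (α * (N : ℝ))
  have hM3 : 3 ≤ ⌊α * (N : ℝ)⌋₊ := Nat.le_floor (by push_cast; linarith)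
  set S := sSup ((fun h : ℝ => Omega h α 3) '' Set.Icc ε t) with hS
  have hbdd : BddAbove ((fun h : ℝ => Omega h α 3) '' Set.Icc ε t) := by
    refine ⟨1, ?_⟩
    rintro _ ⟨h, hh, rfl⟩
    exact Omega_three_le hα.le (hε.le.trans hh.1) (hh.2.trans ht1)
  have hleS : ∀ h : ℝ, 0 ≤ h → h ≤ t → Omega h α 3 ≤ S := by
    intro h h0 h1
    rcases le_total ε h with hh | hh
    · exact le_csSup hbdd ⟨h, ⟨hh, h1⟩, rfl⟩
    · exact (Omega_three_mono hα h0 hh (ht.1.trans ht1) hε'.le).trans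
        (le_csSup hbdd ⟨ε, ⟨le_rfl, ht.1⟩, rfl⟩)
  -- The value at `h = 0` is 0; this absorbs the isolated 1 in `LC_le`.
  have hS0 : 0 ≤ S := by
    have := hleS 0 le_rfl ht0.le
    rwa [Omega_three, survival, show (1 : ℝ) - 3 / 8 * 0 ^ 2 + 1 / 4 * 0 ^ 3 = 1 by norm_num,
      Real.logb_one, mul_zero, add_zero] at this
  have hTN : ⌊t * (N : ℝ)⌋₊ + 3 ≤ N := by
    have : (⌊t * (N : ℝ)⌋₊ : ℝ) + 3 ≤ N := by linarith
    exact_mod_cast this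
  generalize ⌊t * (N : ℝ)⌋₊ = T at *
  generalize ⌊α * (N : ℝ)⌋₊ = M at *
  have hK := le_card_clause hN6
  have hMsq : (M : ℝ) ^ 2 ≤ α ^ 2 * N ^ 2 := by
    rw [← mul_pow]
    exact pow_le_pow_left₀ (Nat.cast_nonneg _) hM 2
  have hN3' : (16 * α ^ 2) * (N : ℝ) ^ 2 ≤ N ^ 3 := by
    rw [pow_succ (N : ℝ) 2, mul_comm ((N : ℝ) ^ 2)]
    exact mul_le_mul_of_nonneg_right hN1 (by positivity)
  have hMK : 2 * M ^ 2 ≤ Fintype.card (Clause N 3) := by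
    have : 2 * (M : ℝ) ^ 2 ≤ Fintype.card (Clause N 3) := by
      have : 0 ≤ α ^ 2 * (N : ℝ) ^ 2 := by positivity
      linarith
    exact_mod_cast this
  -- In the exponent, `4 α` comes from replacing the weight by `survival` and 1 from the rounding of
  -- `α N`, as the weight is at least 1/2.
  have hterm : ∀ H ∈ Finset.range T, 2 ^ H * evolve liveWeight H N none (some 3) ^ M
      ≤ (2 : ℝ) ^ (S * N + (4 * α + 1)) := by
    intro H hH
    have hHT : H < T := Finset.mem_range.1 hH
    have hHT' : (H : ℝ) ≤ T := by exact_mod_cast hHT.le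
    have hH0 : (0 : ℝ) ≤ H := Nat.cast_nonneg H
    have hH3 : H + 3 ≤ N := by omega
    have hud := abs_le.1 (abs_evolve_liveWeight_sub_le hH3 hN6)
    obtain ⟨hu2, hu1⟩ := evolve_liveWeight_bounds hH3 hN6
    set u := evolve liveWeight H N none (some 3)
    have hu0 : 0 < u := by linarith
    have hHt : (H : ℝ) / N ≤ t := by
      rw [div_le_iff₀ hN0]
      linarith
    have hΩ := hleS (H / N) (by positivity) hHt
    rw [Omega_three] at hΩ
    have hq := le_survival (t := H / N) (by positivity) (hHt.trans ht1)
    have hlog := log_sub_log_le (u := u) (v := survival (H / N)) (n := N) (by linarith) hu2 hN0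
      (by linarith [hud.2])
    have hl2 : (1 : ℝ) / 2 < Real.log 2 := by linarith [Real.log_two_gt_d9]
    have hlogb : Real.logb 2 u - Real.logb 2 (survival (H / N)) ≤ 4 / N := by
      rw [Real.logb, Real.logb, ← sub_div, div_le_iff₀ (by linarith)]
      refine hlog.trans ?_
      have : (2 : ℝ) / N = 4 / N * (1 / 2) := by ring
      rw [this]
      exact mul_le_mul_of_nonneg_left hl2.le (by positivity)
    have hlu : Real.logb 2 u ≤ 0 := Real.logb_nonpos (by norm_num) hu0.le hu1
    have hlu' : -1 ≤ Real.logb 2 u := by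
      rw [Real.le_logb_iff_rpow_le (by norm_num) hu0, Real.rpow_neg_one]
      linarith
    have h1 : M * Real.logb 2 u ≤ (α * N - 1) * Real.logb 2 u :=
      mul_le_mul_of_nonpos_right (by linarith) hlu
    have h2 : α * N * (Real.logb 2 u - Real.logb 2 (survival (H / N))) ≤ 4 * α := by
      refine (mul_le_mul_of_nonneg_left hlogb (by positivity)).trans (le_of_eq ?_)
      field_simp
    have h3 := mul_le_mul_of_nonneg_right hΩ hN0.le
    rw [add_mul, div_mul_cancel₀ _ hN0.ne'] at h3
    rw [← Real.logb_le_iff_le_rpow (by norm_num) (by positivity),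
      Real.logb_mul (by positivity) (by positivity), Real.logb_pow, Real.logb_pow,
      Real.logb_self_eq_one (by norm_num)]
    nlinarith
  have hP1 : (1 : ℝ) ≤ (2 : ℝ) ^ (S * N + (4 * α + 1)) :=
    Real.one_le_rpow (by norm_num) (by positivity)
  have hLC := LC_le (σ := σ) (T := T) (N := N) (M := M) (by omega)
  have hTN' : (T : ℝ) + 3 ≤ N := by exact_mod_cast hTN
  -- The factor `N` bounds the number of heights; 8 covers the constants, including the factor 2 for
  -- distinct clauses.
  have hLC' : LC N M σ T ≤ (2 : ℝ) ^ (S * N + (4 * α + 4)) * N := by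
    refine hLC.trans ?_
    have hsum := Finset.sum_le_card_nsmul _ _ _ hterm
    rw [Finset.card_range, nsmul_eq_mul] at hsum
    have e : (2 : ℝ) ^ (S * N + (4 * α + 4)) = 8 * (2 : ℝ) ^ (S * N + (4 * α + 1)) := by
      rw [show S * N + (4 * α + 4) = 3 + (S * N + (4 * α + 1)) by ring,
        Real.rpow_add (by norm_num)]
      norm_num
    have hsum0 : 0 ≤ ∑ H ∈ Finset.range T, 2 ^ H * evolve liveWeight H N none (some 3) ^ M := by
      refine Finset.sum_nonneg fun H hH => ?_
      have hHT : H < T := Finset.mem_range.1 hH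
      have := (evolve_liveWeight_bounds (H := H) (N := N) (by omega) hN6).1
      have : 0 ≤ evolve liveWeight H N none (some 3) := by linarith
      positivity
    refine (mul_le_mul_of_nonneg_right
      (pow_le_two_mul_descFactorial (by omega) hMK) (by linarith)).trans ?_
    rw [e]
    generalize (2 : ℝ) ^ (S * N + (4 * α + 1)) = P at *
    have : (T : ℝ) * P ≤ (N - 3) * P := mul_le_mul_of_nonneg_right (by linarith) (by linarith)
    nlinarith
  have hlog := Real.logb_le_logb_of_le (by norm_num : (1 : ℝ) < 2) hLC0 hLC'
  rw [Real.logb_mul (by positivity) hN0.ne', Real.logb_rpow (by norm_num) (by norm_num)] at hlog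
  nlinarith

end Asymptotics

end DPLL

end

theorem proposition2 (α : ℝ) (hα : 0 < α) :
    ∃ ε₀ : ℝ, 0 < ε₀ ∧ ∀ ε : ℝ, 0 < ε → ε < ε₀ →
      ∀ δ : ℝ, 0 < δ → ∃ N₀ : ℕ, ∀ N : ℕ, N₀ ≤ N →
        ∀ σ : DPLL.UnitRule ⌊α * (N : ℝ)⌋₊, ∀ t ∈ Set.Icc ε (1 - ε),
          0 < DPLL.LC N ⌊α * (N : ℝ)⌋₊ σ ⌊t * (N : ℝ)⌋₊ ∧
          DPLL.Omega t α 3 - δ ≤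
            1 / (N : ℝ) * Real.logb 2 (DPLL.LC N ⌊α * (N : ℝ)⌋₊ σ ⌊t * (N : ℝ)⌋₊) ∧
          1 / (N : ℝ) * Real.logb 2 (DPLL.LC N ⌊α * (N : ℝ)⌋₊ σ ⌊t * (N : ℝ)⌋₊) ≤
            sSup ((fun h : ℝ => DPLL.Omega h α 3) '' Set.Icc ε t) + δ := by
  -- The threshold is the one below which `Omega_three_mono` applies; only the upper bound needs it.
  refine ⟨1 / (2 * α), by positivity, fun ε hε hε' δ hδ => ?_⟩
  obtain ⟨N₀, hN₀⟩ := Filter.eventually_atTop.1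
    (((DPLL.eventually_le_logb_LC hα hε hδ).and
      (DPLL.eventually_logb_LC_le hα hε hε' hδ)).and (Filter.eventually_gt_atTop 0))
  refine ⟨N₀, fun N hN σ t ht => ?_⟩
  obtain ⟨⟨hlow, hup⟩, hN0⟩ := hN₀ N hN
  have hN0' : (0 : ℝ) < N := by exact_mod_cast hN0
  obtain ⟨hpos, hlow⟩ := hlow σ t ht
  refine ⟨hpos, ?_, ?_⟩
  · rw [one_div, inv_mul_eq_div, le_div_iff₀ hN0']
    exact hlow
  · rw [one_div, inv_mul_eq_div, div_le_iff₀ hN0']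
    exact hup σ t ht hpos
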